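/- Let $X$ be a compact geodesic metric space (any two points $x,y$ are joined by an isometrically embedded copy of $[0,d(x,y)]$) which is semi-locally simply connected (every point $x$ has a neighbourhood $U$ such that every loop in $U$ based at $x$ is null-homotopic in $X$), and let $\bullet\in X$. For $r>0$ let $\mathrm{Rips}(X,r)$ be the open Rips complex, with vertex set $X$ and with the non-empty finite subsets of $X$ of diameter $<r$ as simplices. The open-Rips $\pi_1$-persistence of $X$ consists of the groups $\pi_1(\mathrm{Rips}(X,r),\bullet)$, $r>0$, together with the homomorphisms $i_{p,q}\colon\pi_1(\mathrm{Rips}(X,p),\bullet)\to\pi_1(\mathrm{Rips}(X,q),\bullet)$, $p<q$, induced by inclusion. A number $p>0$ is a critical value if $i_{p-\varepsilon,p}$ is not an isomorphism for all small enough $\varepsilon>0$, or if $i_{p,p+\varepsilon}$ is not an isomorphism for all $\varepsilon>0$. A geodesic circle of length $l>0$ is an isometric embedding into $X$ of the circle of circumference $l$ with its arc-length metric. A geodesic lasso is a loop $\alpha*\beta*\alpha^-$ based at $\bullet$, where $\alpha$ is a path starting at $\bullet$ that is a local geodesic (constant speed, all sufficiently short pieces distance-minimizing; constant paths are allowed)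 and $\beta$ is a geodesic circle based at the endpoint of $\alpha$. Then: 1. The open-Rips $\pi_1$-persistence of $X$ has only finitely many critical values. 2. $\pi_1(X,\bullet)$ is generated by (the classes of) finitely many geodesic lassos. 3. For each critical value $q$ there is at least one geodesic circle of length $3q$, and the geodesic circles of length $3q$ represent only finitely many free homotopy classes. 4. The geodesic circles in $X$, of all lengths, represent only finitely many free homotopy classes. -/

import Mathlib

open Topology

/-- A geodesic space: any two points `x`, `y` are joined by an isometric copy of `[0, d(x, y)]`. -/
def IsGeodesicSpace (X : Type*) [MetricSpace X] : Prop :=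
  ∀ x y : X, ∃ γ : ℝ → X, γ 0 = x ∧ γ (dist x y) = y ∧
    ∀ s ∈ Set.Icc (0 : ℝ) (dist x y), ∀ t ∈ Set.Icc (0 : ℝ) (dist x y),
      dist (γ s) (γ t) = |s - t|

/-- Semi-locally simply connected: `X` is path-connected and every point `x` has a neighbourhood
`U` such that every loop in `U` based at `x` is null-homotopic in `X`. -/
def IsSLSC (X : Type*) [TopologicalSpace X] : Prop :=
  PathConnectedSpace X ∧
    ∀ x : X, ∃ U ∈ 𝓝 x, ∀ γ : Path x x, Set.range γ ⊆ U → γ.Homotopic (Path.refl x)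

/-! ### Geometric realization of an abstract simplicial complex -/

/-- A point of the geometric realization `|K|`: finitely supported barycentric coordinates which
are non-negative, sum to `1`, and whose support is a simplex of `K`. -/
@[ext]
structure GeomRealization {V : Type*} (K : AbstractSimplicialComplex V) where
  coord : V →₀ ℝ
  nonneg : ∀ v, 0 ≤ coord v
  sum_eq_one : ∑ v ∈ coord.support, coord v = 1
  support_mem : coord.support ∈ K.faces

namespace GeomRealization

variable {V : Type*}

/-- The characteristic map of a simplex `σ` of `K`: the standard simplex with vertex set `σ` is
mapped to `|K|` by extending barycentric coordinates by zero. -/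
noncomputable def simplexMap (K : AbstractSimplicialComplex V) (σ : K.faces)
    (p : stdSimplex ℝ σ.1) : GeomRealization K where
  coord := (Finsupp.equivFunOnFinite.symm p.1).embDomain
    (Function.Embedding.subtype (· ∈ σ.1))
  nonneg v := by
    by_cases hv : v ∈ Set.range (Function.Embedding.subtype (· ∈ σ.1))
    · obtain ⟨w, rfl⟩ := hv
      rw [Finsupp.embDomain_apply_self]
      exact p.2.1 w
    · rw [Finsupp.embDomain_of_notMem_range _ _ _ hv]
  sum_eq_one := by
    rw [Finsupp.support_embDomain, Finset.sum_map]
    simp only [Finsupp.embDomain_apply_self]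
    rw [← p.2.2]
    refine Finset.sum_subset (Finset.subset_univ _) fun w _ hw => ?_
    exact Finsupp.notMem_support_iff.mp hw
  support_mem := by
    refine (K.isRelLowerSet_faces σ.2).2 ?_ ?_
    · intro v hv
      rw [Finsupp.support_embDomain, Finset.mem_map] at hv
      obtain ⟨w, _, rfl⟩ := hv
      exact w.2
    · rw [Finsupp.support_embDomain, Finset.map_nonempty, Finset.nonempty_iff_ne_empty]
      intro h
      have h0 : ∀ w : σ.1, p.1 w = 0 := fun w => by
        have hw : w ∉ (Finsupp.equivFunOnFinite.symm
          p.1).support := by simp [h]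
        exact Finsupp.notMem_support_iff.mp hw
      have h1 := p.2.2
      simp [h0] at h1

/-- The weak topology: a set is open iff its preimage in every (closed) simplex is open. -/
noncomputable instance (K : AbstractSimplicialComplex V) : TopologicalSpace (GeomRealization K) :=
  ⨆ σ : K.faces, TopologicalSpace.coinduced (simplexMap K σ) inferInstance

/-- The vertex `v`, as a point of `|K|`. -/
noncomputable def vertex (K : AbstractSimplicialComplex V) (v : V) : GeomRealization K where
  coord := Finsupp.single v 1
  nonneg w := by
    classical
    rw [Finsupp.single_apply]
    split_ifs <;> norm_num
  sum_eq_one := by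
    rw [Finsupp.support_single v (one_ne_zero : (1 : ℝ) ≠ 0)]
    simp
  support_mem := by
    rw [Finsupp.support_single v (one_ne_zero : (1 : ℝ) ≠ 0)]
    exact K.singleton_mem v

/-- The map `|K| → |L|` induced by the inclusion of a subcomplex `K` of `L`
(the identity on vertices). -/
def inclusion {K L : AbstractSimplicialComplex V} (h : K.faces ⊆ L.faces) :
    C(GeomRealization K, GeomRealization L) where
  toFun p := ⟨p.coord, p.nonneg, p.sum_eq_one, h p.support_mem⟩
  continuous_toFun := by
    refine continuous_iSup_dom.2 fun σ => continuous_coinduced_dom.2 ?_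
    exact continuous_iSup_rng (i := (⟨σ.1, h σ.2⟩ : L.faces)) continuous_coinduced_rng

theorem inclusion_vertex {K L : AbstractSimplicialComplex V} (h : K.faces ⊆ L.faces) (v : V) :
    inclusion h (vertex K v) = vertex L v := rfl

end GeomRealization

/-! ### The `π₁`-persistence of the open Rips filtration -/

/-- The open Rips complex: vertices are the points of `X`, simplices are the non-empty finite
subsets of diameter `< r`. -/
def ripsComplex (X : Type*) [MetricSpace X] (r : ℝ) (hr : 0 < r) : AbstractSimplicialComplex X where
  faces := {σ | σ.Nonempty ∧ Metric.diam (σ : Set X) < r}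
  isRelLowerSet_faces := by
    intro σ hσ
    refine ⟨hσ.1, fun τ hτσ hτ => ⟨hτ, lt_of_le_of_lt ?_ hσ.2⟩⟩
    exact Metric.diam_mono (by exact_mod_cast hτσ) σ.finite_toSet.isBounded
  singleton_mem v := by simpa using hr

theorem ripsComplex_faces_mono (X : Type*) [MetricSpace X] {p q : ℝ} (hp : 0 < p) (hq : 0 < q)
    (hpq : p ≤ q) : (ripsComplex X p hp).faces ⊆ (ripsComplex X q hq).faces :=
  fun _ hσ => ⟨hσ.1, lt_of_lt_of_le hσ.2 hpq⟩

/-- The bonding homomorphism `π₁(Rips(X, p), x₀) → π₁(Rips(X, q), x₀)`, for `0 < p ≤ q`. -/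
noncomputable def ripsPi1Map {X : Type*} [MetricSpace X] (x₀ : X) (p q : ℝ) (hp : 0 < p)
    (hq : 0 < q) (hpq : p ≤ q) :
    FundamentalGroup (GeomRealization (ripsComplex X p hp))
        (GeomRealization.vertex (ripsComplex X p hp) x₀) →*
      FundamentalGroup (GeomRealization (ripsComplex X q hq))
        (GeomRealization.vertex (ripsComplex X q hq) x₀) :=
  FundamentalGroup.mapOfEq
    (GeomRealization.inclusion (ripsComplex_faces_mono X hp hq hpq))
    (GeomRealization.inclusion_vertex (ripsComplex_faces_mono X hp hq hpq) x₀)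

/-- `p > 0` is a left critical value: for all small enough `ε > 0` the bonding map from `p - ε`
to `p` is not an isomorphism. -/
def IsLeftCriticalValue {X : Type*} [MetricSpace X] (x₀ : X) (p : ℝ) : Prop :=
  ∃ hp : 0 < p, ∃ ε₀ > 0, ∀ (ε : ℝ) (hε : 0 < ε) (_ : ε < ε₀) (hpε : 0 < p - ε),
    ¬ Function.Bijective (ripsPi1Map x₀ (p - ε) p hpε hp (sub_le_self p hε.le))

/-- `p > 0` is a right critical value: for all `ε > 0` the bonding map from `p` to `p + ε` is not
an isomorphism. -/
def IsRightCriticalValue {X : Type*} [MetricSpace X] (x₀ : X) (p : ℝ) : Prop :=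
  ∃ hp : 0 < p, ∀ (ε : ℝ) (hε : 0 < ε),
    ¬ Function.Bijective
      (ripsPi1Map x₀ p (p + ε) hp (add_pos hp hε) (le_add_of_nonneg_right hε.le))

/-- Critical values of the `π₁`-persistence of `(X, x₀)` via the open Rips filtration. -/
def IsCriticalValue {X : Type*} [MetricSpace X] (x₀ : X) (p : ℝ) : Prop :=
  IsLeftCriticalValue x₀ p ∨ IsRightCriticalValue x₀ p

/-! ### Geodesic circles and geodesic lassos -/

/-- `c` is a geodesic circle of length `l > 0`: an isometric embedding of the circle of
circumference `l` with its arc-length metric. Here `UnitAddCircle = ℝ ⧸ ℤ` carries the arc-length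
metric of circumference `1`, so the circle of circumference `l` is this one rescaled by `l`. -/
def IsGeodesicCircle {X : Type*} [MetricSpace X] (l : ℝ) (c : C(UnitAddCircle, X)) : Prop :=
  0 < l ∧ ∀ s t : UnitAddCircle, dist (c s) (c t) = l * dist s t

/-- Two closed curves are identified when they are freely homotopic. -/
def freeHomotopySetoid (X : Type*) [TopologicalSpace X] : Setoid C(UnitAddCircle, X) :=
  ⟨ContinuousMap.Homotopic, ContinuousMap.Homotopic.equivalence⟩

/-- The free homotopy class of a closed curve. -/
def freeHomotopyClass {X : Type*} [TopologicalSpace X] (c : C(UnitAddCircle, X)) :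
    Quotient (freeHomotopySetoid X) :=
  Quotient.mk (freeHomotopySetoid X) c

/-- A path is a (local) geodesic if it has constant speed `v ≥ 0` and all its sufficiently short
pieces minimize distance. Constant paths are allowed. -/
def IsLocalGeodesic {X : Type*} [MetricSpace X] {x y : X} (α : Path x y) : Prop :=
  ∃ v : ℝ, 0 ≤ v ∧ ∃ δ > 0, ∀ s t : unitInterval, dist s t < δ →
    dist (α s) (α t) = v * dist s t

/-- The loop based at `c 0` obtained by going once around the closed curve `c`. -/
def circleLoop {X : Type*} [TopologicalSpace X] (c : C(UnitAddCircle, X)) : Path (c 0) (c 0) where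
  toFun t := c ((t : ℝ) : UnitAddCircle)
  continuous_toFun :=
    c.continuous.comp ((AddCircle.continuous_mk' (1 : ℝ)).comp continuous_subtype_val)
  source' := by simp
  target' := by simp [AddCircle.coe_period]

/-- The classes in `π₁(X, x₀)` of geodesic lassos `α * β * α⁻`, where `α` is a geodesic path
starting at `x₀` and `β` is a geodesic circle based at the endpoint of `α`. -/
def geodesicLassoClasses {X : Type*} [MetricSpace X] (x₀ : X) : Set (FundamentalGroup X x₀) :=
  {g | ∃ (l : ℝ) (c : C(UnitAddCircle, X)) (α : Path x₀ (c 0)),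
    IsGeodesicCircle l c ∧ IsLocalGeodesic α ∧
      g = FundamentalGroup.fromPath
        (Path.Homotopic.Quotient.mk ((α.trans (circleLoop c)).trans α.symm))}

/-!
By compactness there is a scale `R` below which loops are null-homotopic, so short paths are
homotopic to geodesics and uniformly `R / 2`-close closed curves are freely homotopic. Hence, by
Arzelà–Ascoli, closed curves of bounded Lipschitz constant represent only finitely many free
homotopy classes; geodesic circles have length at most twice the diameter of `X`.

Let `φ` be a functor from the fundamental groupoid of `X` to a group. A shortest loop among those
which `φ` does not kill is a geodesic circle: a shortcut would cut it into two shorter loops, one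
of which `φ` does not kill. Applied to the quotient of `π₁(X, x₀)` by the normal closure of the
geodesic lassos, this shows that the lassos generate; their set is conjugation invariant because
every path is homotopic to a local geodesic.

A locally constant cocycle on an open cover has a holonomy along paths, computed by a covering
space. Edges of `Rips(X, r)` define such a cocycle on `X` with values in `π₁(Rips(X, r), x₀)`; its
holonomy `θ_r` kills all loops of length less than `3 r`, which bound a triangle of the Rips
complex. If `θ_p` also kills all loops of length less than `3 q`, it defines a cocycle on the open
stars of `Rips(X, q)`, whose holonomy inverts the bonding map. So if the bonding map from `p` to
`q` is not an isomorphism (it is always onto), a shortest loop with `θ_p ≠ 1` is a geodesic circle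
of length in `[3 p, 3 q)`. By finiteness of the free homotopy classes this forces every critical
value `q` to come with a geodesic circle of length `3 q` on which `θ_q ≠ 1`, whereas `θ_q` kills
the shorter circles. Circles attached to different critical values are thus not freely homotopic.
-/

local notation "⟦" γ "⟧ₕ" => Path.Homotopic.Quotient.mk γ

/-! ### The fundamental groupoid -/

theorem iff_of_eventually_iff {X : Type*} [TopologicalSpace X] [PreconnectedSpace X]
    {P : X → Prop} (h : ∀ x, ∀ᶠ y in 𝓝 x, (P y ↔ P x)) (x y : X) : P x ↔ P y := by
  have hP : IsLocallyConstant P :=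
    IsLocallyConstant.iff_eventually_eq P |>.2 fun x => (h x).mono fun _ => propext
  exact iff_of_eq
    (hP.apply_eq_of_isPreconnected isPreconnected_univ (Set.mem_univ x) (Set.mem_univ y))

theorem eventually_subpath_mem {X : Type*} [TopologicalSpace X] {x y : X} (γ : Path x y)
    (t : unitInterval) {O : Set X} (hO : O ∈ 𝓝 (γ t)) :
    ∀ᶠ s in 𝓝 t, ∀ r, γ.subpath t s r ∈ O := by
  have hc : Continuous fun p : unitInterval × unitInterval => γ.subpath t p.1 p.2 :=
    γ.subpath_continuous_family.comp
      (by fun_prop : Continuous fun p : unitInterval × unitInterval => (t, p.1, p.2))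
  have := isCompact_univ.eventually_forall_of_forall_eventually (x₀ := t)
    (P := fun s r => γ.subpath t s r ∈ O) (K := (Set.univ : Set unitInterval)) fun r _ =>
      hc.continuousAt.preimage_mem_nhds (by simpa using hO)
  simpa using this

/-- Homotopy classes of paths relative to the endpoints, i.e. the morphisms of the fundamental
groupoid. -/
abbrev PathClass {X : Type*} [TopologicalSpace X] (x y : X) := Path.Homotopic.Quotient x y

namespace PathClass

variable {X Y : Type*} [TopologicalSpace X] [TopologicalSpace Y] {x y z : X}

theorem symm_trans_cancel_left (p : PathClass y x) (q : PathClass x z) :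
    p.symm.trans (p.trans q) = q := by
  rw [← Path.Homotopic.Quotient.trans_assoc, Path.Homotopic.Quotient.symm_trans,
    Path.Homotopic.Quotient.refl_trans]

theorem symm_symm (p : PathClass x y) : p.symm.symm = p := by
  obtain ⟨γ, rfl⟩ := Path.Homotopic.Quotient.mk_surjective p
  simp only [← Path.Homotopic.Quotient.mk_symm, Path.symm_symm]

theorem trans_symm_cancel_left (p : PathClass x y) (q : PathClass x z) :
    p.trans (p.symm.trans q) = q := by
  simpa only [symm_symm] using symm_trans_cancel_left p.symm q

theorem symm_trans_rev (p : PathClass x y) (q : PathClass y z) :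
    (p.trans q).symm = q.symm.trans p.symm := by
  obtain ⟨γ, rfl⟩ := Path.Homotopic.Quotient.mk_surjective p
  obtain ⟨δ, rfl⟩ := Path.Homotopic.Quotient.mk_surjective q
  simp only [← Path.Homotopic.Quotient.mk_symm, ← Path.Homotopic.Quotient.mk_trans,
    Path.trans_symm]

theorem conj_eq_refl_iff (a : PathClass x y) (p : PathClass y y) :
    (a.trans p).trans a.symm = Path.Homotopic.Quotient.refl x ↔
      p = Path.Homotopic.Quotient.refl y := by
  constructor
  · intro h
    calc p = a.symm.trans (((a.trans p).trans a.symm).trans a) := by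
          simp only [Path.Homotopic.Quotient.trans_assoc, symm_trans_cancel_left,
            Path.Homotopic.Quotient.symm_trans, Path.Homotopic.Quotient.trans_refl]
      _ = Path.Homotopic.Quotient.refl y := by
          rw [h, Path.Homotopic.Quotient.refl_trans, Path.Homotopic.Quotient.symm_trans]
  · rintro rfl
    rw [Path.Homotopic.Quotient.trans_refl, Path.Homotopic.Quotient.trans_symm]

theorem trans_symm_eq_refl_iff {p q : PathClass x y} :
    p.trans q.symm = Path.Homotopic.Quotient.refl x ↔ p = q := by
  constructor
  · intro h
    calc p = (p.trans q.symm).trans q := by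
          rw [Path.Homotopic.Quotient.trans_assoc, Path.Homotopic.Quotient.symm_trans,
            Path.Homotopic.Quotient.trans_refl]
      _ = q := by rw [h, Path.Homotopic.Quotient.refl_trans]
  · rintro rfl
    exact Path.Homotopic.Quotient.trans_symm p

theorem map_trans (f : C(X, Y)) (p : PathClass x y) (q : PathClass y z) :
    (p.trans q).map f = (p.map f).trans (q.map f) := by
  obtain ⟨γ, rfl⟩ := Path.Homotopic.Quotient.mk_surjective p
  obtain ⟨δ, rfl⟩ := Path.Homotopic.Quotient.mk_surjective q
  simp only [← Path.Homotopic.Quotient.mk_map, ← Path.Homotopic.Quotient.mk_trans, Path.map_trans]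

theorem mk_subpath_trans (γ : Path x y) (r s t : unitInterval) :
    ⟦γ.subpath r s⟧ₕ.trans ⟦γ.subpath s t⟧ₕ = ⟦γ.subpath r t⟧ₕ :=
  Path.Homotopic.Quotient.eq.2 ⟨Path.Homotopy.subpathTransSubpath γ r s t⟩

theorem local_induction {P : ∀ x y : X, PathClass x y → Prop}
    (trans : ∀ {x y z : X} (p : PathClass x y) (q : PathClass y z),
      P x y p → P y z q → P x z (p.trans q))
    (small : ∀ z : X, ∃ O ∈ 𝓝 z, ∀ {x y : X} (γ : Path x y), (∀ t, γ t ∈ O) → P x y ⟦γ⟧ₕ)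
    {x y : X} (p : PathClass x y) : P x y p := by
  obtain ⟨γ, rfl⟩ := Path.Homotopic.Quotient.mk_surjective p
  have h_iff : P _ _ ⟦γ.subpath 0 0⟧ₕ ↔ P _ _ ⟦γ.subpath 0 1⟧ₕ := by
    refine iff_of_eventually_iff (P := fun t => P _ _ ⟦γ.subpath 0 t⟧ₕ) (fun t => ?_) 0 1
    obtain ⟨O, hO, hP⟩ := small (γ t)
    filter_upwards [eventually_subpath_mem γ t hO] with s hs
    constructor <;> intro h
    · rw [← mk_subpath_trans γ 0 s t]
      refine trans _ _ h (hP _ fun r => ?_)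
      rw [← Path.symm_subpath]
      exact hs _
    · rw [← mk_subpath_trans γ 0 t s]
      exact trans _ _ h (hP _ hs)
  have h_zero : P _ _ ⟦γ.subpath 0 0⟧ₕ := by
    obtain ⟨O, hO, hP⟩ := small (γ 0)
    exact hP _ fun r => by simpa using mem_of_mem_nhds hO
  have h_cast : ∀ {x' y' : X} (hx : x' = x) (hy : y' = y),
      P x' y' ⟦γ.cast hx hy⟧ₕ → P x y ⟦γ⟧ₕ := by
    rintro _ _ rfl rfl h; exact h
  exact h_cast γ.source γ.target (by simpa only [Path.subpath_zero_one] using h_iff.1 h_zero)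

end PathClass

/-- A functor from the fundamental groupoid of `Y` to the group `G`. Composition of paths is
turned into multiplication from right to left, as in `FundamentalGroup`. -/
structure PathHom (Y : Type*) [TopologicalSpace Y] (G : Type*) [Group G] where
  toFun : ∀ {x y : Y}, PathClass x y → G
  map_trans' : ∀ {x y z : Y} (p : PathClass x y) (q : PathClass y z),
    toFun (p.trans q) = toFun q * toFun p

namespace PathHom

variable {X Y : Type*} [TopologicalSpace X] [TopologicalSpace Y] {G H : Type*} [Group G] [Group H]

instance : CoeFun (PathHom Y G) (fun _ => ∀ {x y : Y}, PathClass x y → G) := ⟨toFun⟩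

variable (φ : PathHom Y G) {x y : Y}

theorem map_trans {z : Y} (p : PathClass x y) (q : PathClass y z) : φ (p.trans q) = φ q * φ p :=
  φ.map_trans' p q

@[simp]
theorem map_refl (x : Y) : φ (Path.Homotopic.Quotient.refl x) = 1 := by
  have h := φ.map_trans (.refl x) (.refl x)
  rw [Path.Homotopic.Quotient.trans_refl] at h
  exact left_eq_mul.mp h

@[simp]
theorem map_symm (p : PathClass x y) : φ p.symm = (φ p)⁻¹ := by
  rw [eq_inv_iff_mul_eq_one, ← map_trans, Path.Homotopic.Quotient.trans_symm, map_refl]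

@[simp]
theorem map_cast (p : PathClass x y) {x' y' : Y} (hx : x' = x) (hy : y' = y) :
    φ (p.cast hx hy) = φ p := by
  subst hx hy
  rw [Path.Homotopic.Quotient.cast_rfl_rfl]

theorem map_eq_one_iff_of_trans_eq {x' : Y} {p : PathClass x x} {p' : PathClass x' x'}
    {a : PathClass x x'} (h : p.trans a = a.trans p') : φ p = 1 ↔ φ p' = 1 := by
  have h_conj : φ a * φ p = φ p' * φ a := by rw [← map_trans, ← map_trans, h]
  rw [eq_mul_inv_of_mul_eq h_conj.symm, mul_inv_eq_one, mul_eq_left]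

/-- Postcomposition of a `PathHom` with a group homomorphism. -/
def postcomp (f : G →* H) : PathHom Y H where
  toFun p := f (φ p)
  map_trans' p q := by rw [φ.map_trans, _root_.map_mul]

/-- Precomposition of a `PathHom` with the functor induced by a continuous map. -/
def precomp (f : C(X, Y)) : PathHom X G where
  toFun p := φ (p.map f)
  map_trans' p q := by rw [PathClass.map_trans, φ.map_trans]

/-- A choice `τ` of paths from a base point `y₀` to all points retracts the fundamental groupoid
to the fundamental group at `y₀`. -/
noncomputable def ofBasePaths {y₀ : Y} (τ : ∀ y, PathClass y₀ y) :
    PathHom Y (FundamentalGroup Y y₀) where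
  toFun {x y} p := FundamentalGroup.fromPath (((τ x).trans p).trans (τ y).symm)
  map_trans' p q := by
    rw [FundamentalGroup.mul_def]
    simp only [Path.Homotopic.Quotient.trans_assoc, PathClass.symm_trans_cancel_left]

theorem ofBasePaths_eq_one_iff {y₀ : Y} (τ : ∀ y, PathClass y₀ y) (p : PathClass x x) :
    ofBasePaths τ p = 1 ↔ p = Path.Homotopic.Quotient.refl x :=
  PathClass.conj_eq_refl_iff (τ x) p

theorem ofBasePaths_loop {y₀ : Y} {τ : ∀ y, PathClass y₀ y}
    (hτ : τ y₀ = Path.Homotopic.Quotient.refl y₀) (p : PathClass y₀ y₀) :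
    ofBasePaths τ p = FundamentalGroup.fromPath p := by
  change FundamentalGroup.fromPath (((τ y₀).trans p).trans (τ y₀).symm) = _
  rw [hτ, Path.Homotopic.Quotient.refl_trans, ← Path.Homotopic.Quotient.mk_refl,
    ← Path.Homotopic.Quotient.mk_symm, Path.refl_symm, Path.Homotopic.Quotient.mk_refl,
    Path.Homotopic.Quotient.trans_refl]

end PathHom

/-! ### Holonomy of locally constant cocycles -/

/-- A locally constant `G`-valued cocycle `trans` subordinate to the open cover `cover` of `Y`,
together with a choice `index` of a chart around every point. -/
structure LocallyConstantCocycle (Y ι G : Type*) [TopologicalSpace Y] [Group G] where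
  cover : ι → Set Y
  isOpen_cover : ∀ i, IsOpen (cover i)
  index : Y → ι
  mem_cover_index : ∀ y, y ∈ cover (index y)
  trans : ι → ι → G
  trans_mul_trans : ∀ i j k, (cover i ∩ cover j ∩ cover k).Nonempty →
    trans j k * trans i j = trans i k

namespace LocallyConstantCocycle

variable {Y ι G : Type*} [TopologicalSpace Y] [Group G] (c : LocallyConstantCocycle Y ι G)

theorem trans_self {i : ι} (h : (c.cover i).Nonempty) : c.trans i i = 1 := by
  refine mul_eq_left.mp (c.trans_mul_trans i i i ?_)
  simpa only [Set.inter_self] using h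

/-- The principal bundle with discrete structure group `G` and transition functions
`v ↦ c.trans i j * v`. -/
def bundle [TopologicalSpace G] [DiscreteTopology G] : FiberBundleCore ι Y G where
  baseSet := c.cover
  isOpen_baseSet := c.isOpen_cover
  indexAt := c.index
  mem_baseSet_at := c.mem_cover_index
  coordChange i j _ v := c.trans i j * v
  coordChange_self i x hx v := by rw [c.trans_self ⟨x, hx⟩, one_mul]
  continuousOn_coordChange i j := by
    have : Continuous fun p : Y × G => c.trans i j * p.2 :=
      (continuous_of_discreteTopology (f := fun v => c.trans i j * v)).comp continuous_snd
    exact this.continuousOn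
  coordChange_comp i j k x hx v := by rw [← mul_assoc, c.trans_mul_trans i j k ⟨x, hx⟩]

section Transport

variable [TopologicalSpace G] [DiscreteTopology G]

theorem isCoveringMap_proj : IsCoveringMap c.bundle.proj :=
  FiberBundle.isCoveringMap (F := G) (E := c.bundle.Fiber)

/-- The fibre of the bundle over `x`, identified with `G` by the chart chosen at `x`. -/
def fiberEquiv (x : Y) : G ≃ c.bundle.proj ⁻¹' {x} where
  toFun v := ⟨⟨x, v⟩, rfl⟩
  invFun u := u.1.2
  left_inv _ := rfl
  right_inv := by rintro ⟨⟨_, v⟩, rfl⟩; rfl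

/-- Monodromy of the bundle, in the charts chosen at the endpoints of the path. -/
noncomputable def transport {x y : Y} (p : PathClass x y) (v : G) : G :=
  (c.fiberEquiv y).symm (c.isCoveringMap_proj.monodromy p (c.fiberEquiv x v))

theorem transport_trans {x y z : Y} (p : PathClass x y) (q : PathClass y z) (v : G) :
    c.transport (p.trans q) v = c.transport q (c.transport p v) := by
  simp only [transport, Equiv.apply_symm_apply, c.isCoveringMap_proj.monodromy_trans_apply]

theorem transport_mk {k : ι} {x y : Y} (γ : Path x y) (hγ : ∀ t, γ t ∈ c.cover k) (v : G) :
    c.transport ⟦γ⟧ₕ v = c.trans k (c.index y) * (c.trans (c.index x) k * v) := by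
  rw [transport, Equiv.symm_apply_eq]
  let lift : C(unitInterval, c.bundle.TotalSpace) :=
    ⟨fun t => (c.bundle.localTriv k).invFun (γ t, c.trans (c.index x) k * v), by
      refine (c.bundle.localTriv k).continuousOn_invFun.comp_continuous (by fun_prop) fun t => ?_
      rw [(c.bundle.localTriv k).target_eq]
      exact ⟨hγ t, trivial⟩⟩
  have lift_apply : ∀ t, lift t =
      ⟨γ t, c.trans k (c.index (γ t)) * (c.trans (c.index x) k * v)⟩ := fun _ => rfl
  have hx : c.trans k (c.index x) * c.trans (c.index x) k = 1 := by
    have hxk : x ∈ c.cover k := by simpa using hγ 0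
    have hxi := c.mem_cover_index x
    rw [c.trans_mul_trans _ k _ ⟨x, ⟨hxi, hxk⟩, hxi⟩, c.trans_self ⟨x, hxi⟩]
  have lift_zero : lift 0 = (c.fiberEquiv x v).1 := by
    rw [lift_apply, γ.source, ← mul_assoc, hx, one_mul]; rfl
  have lift_one : lift 1 =
      (c.fiberEquiv y (c.trans k (c.index y) * (c.trans (c.index x) k * v))).1 := by
    rw [lift_apply, γ.target]; rfl
  refine c.isCoveringMap_proj.monodromy_eq_of_map_eq ⟦⟨lift, lift_zero, lift_one⟩⟧ₕ ?_
  exact congrArg Path.Homotopic.Quotient.mk (Path.ext rfl)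

theorem transport_eq_mul {x y : Y} (p : PathClass x y) (v : G) :
    c.transport p v = c.transport p 1 * v := by
  refine PathClass.local_induction
    (P := fun x y (p : PathClass x y) => ∀ v, c.transport p v = c.transport p 1 * v)
    (fun p q hp hq v => ?_) (fun z => ?_) p v
  · rw [transport_trans, transport_trans, hq, hp, hq (c.transport p 1), mul_assoc]
  · refine ⟨_, (c.isOpen_cover _).mem_nhds (c.mem_cover_index z), fun γ hγ v => ?_⟩
    rw [transport_mk c γ hγ, transport_mk c γ hγ, mul_one, mul_assoc]

end Transport

/-- The holonomy of a locally constant cocycle, i.e. the monodromy of the covering space which it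
defines. -/
noncomputable def holonomy : PathHom Y G :=
  letI : TopologicalSpace G := ⊥
  haveI : DiscreteTopology G := ⟨rfl⟩
  { toFun := fun p => c.transport p 1
    map_trans' := fun p q => by rw [transport_trans, transport_eq_mul] }

theorem holonomy_mk {k : ι} {x y : Y} (γ : Path x y) (hγ : ∀ t, γ t ∈ c.cover k) :
    c.holonomy ⟦γ⟧ₕ = c.trans k (c.index y) * c.trans (c.index x) k := by
  let _ : TopologicalSpace G := ⊥
  have _ : DiscreteTopology G := ⟨rfl⟩
  exact (c.transport_mk γ hγ 1).trans (by rw [mul_one])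

end LocallyConstantCocycle

namespace GeomRealization

variable {V : Type*} {K : AbstractSimplicialComplex V}

/-! ### Segments in the geometric realization -/

theorem continuous_simplexMap (σ : K.faces) : Continuous (simplexMap K σ) :=
  continuous_iSup_rng (i := σ) continuous_coinduced_rng

theorem isOpen_iff {s : Set (GeomRealization K)} :
    IsOpen s ↔ ∀ σ : K.faces, IsOpen (simplexMap K σ ⁻¹' s) := by
  rw [isOpen_iSup_iff]; rfl

theorem continuous_of_isOpen {Z : Type*} [TopologicalSpace Z] {U : Set (GeomRealization K)}
    (hU : IsOpen U) {f : U → Z}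
    (hf : ∀ σ : K.faces, Continuous fun a : simplexMap K σ ⁻¹' U => f ⟨simplexMap K σ a, a.2⟩) :
    Continuous f := by
  refine continuous_def.2 fun O hO => ?_
  rw [hU.isOpenEmbedding_subtypeVal.isOpen_iff_image_isOpen, isOpen_iff]
  intro σ
  have hσ : IsOpen (simplexMap K σ ⁻¹' U) := hU.preimage (continuous_simplexMap σ)
  convert hσ.isOpenEmbedding_subtypeVal.isOpenMap _ (hO.preimage (hf σ)) using 1
  ext a
  constructor
  · rintro ⟨p, hp, hpa⟩
    have ha : simplexMap K σ a ∈ U := hpa ▸ p.2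
    obtain rfl : ⟨simplexMap K σ a, ha⟩ = p := Subtype.ext hpa.symm
    exact ⟨⟨a, ha⟩, hp, rfl⟩
  · rintro ⟨a, ha, rfl⟩
    exact ⟨_, ha, rfl⟩

theorem simplexMap_coord (σ : K.faces) (a : stdSimplex ℝ σ.1) (v : σ.1) :
    (simplexMap K σ a).coord v = a.1 v :=
  Finsupp.embDomain_apply_self (Function.Embedding.subtype (· ∈ σ.1)) _ v

theorem simplexMap_coord_of_notMem (σ : K.faces) (a : stdSimplex ℝ σ.1) {v : V} (hv : v ∉ σ.1) :
    (simplexMap K σ a).coord v = 0 := by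
  refine Finsupp.embDomain_of_notMem_range _ _ _ ?_
  rintro ⟨w, rfl⟩
  exact hv w.2

theorem exists_simplexMap_eq (σ : K.faces) {p : GeomRealization K} (hp : p.coord.support ⊆ σ.1) :
    ∃ a, simplexMap K σ a = p := by
  refine ⟨⟨fun v => p.coord v, fun v => p.nonneg v, ?_⟩, ?_⟩
  · rw [Finset.sum_coe_sort σ.1 fun v => p.coord v, ← p.sum_eq_one]
    exact (Finset.sum_subset hp fun v _ hv => Finsupp.notMem_support_iff.1 hv).symm
  · ext v
    by_cases hv : v ∈ σ.1
    · exact simplexMap_coord σ _ ⟨v, hv⟩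
    · rw [simplexMap_coord_of_notMem σ _ hv]
      exact (Finsupp.notMem_support_iff.1 fun h => hv (hp h)).symm

theorem support_simplexMap_subset (σ : K.faces) (a : stdSimplex ℝ σ.1) :
    (simplexMap K σ a).coord.support ⊆ σ.1 := fun v hv => by
  by_contra h
  exact Finsupp.mem_support_iff.1 hv (simplexMap_coord_of_notMem σ a h)

/-- The straight path from `a` to `b` in a standard simplex. -/
noncomputable def line {ι : Type*} [Fintype ι] (a b : stdSimplex ℝ ι) : Path a b where
  toFun t := ⟨(1 - t : ℝ) • a.1 + (t : ℝ) • b.1,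
    convex_stdSimplex ℝ ι a.2 b.2 (by linarith [t.2.2]) t.2.1 (by ring)⟩
  continuous_toFun := Continuous.subtype_mk (by fun_prop) _
  source' := by ext v; simp
  target' := by ext v; simp

theorem continuous_line {ι : Type*} [Fintype ι] (b : stdSimplex ℝ ι) :
    Continuous fun q : stdSimplex ℝ ι × unitInterval => line q.1 b q.2 := by
  refine Continuous.subtype_mk ?_ _
  fun_prop

theorem simplexMap_line_coord (σ : K.faces) (a b : stdSimplex ℝ σ.1) (t : unitInterval) (v : V) :
    (simplexMap K σ (line a b t)).coord v =
      (1 - t) * (simplexMap K σ a).coord v + t * (simplexMap K σ b).coord v := by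
  by_cases hv : v ∈ σ.1
  · simp only [simplexMap_coord σ _ ⟨v, hv⟩]
    rfl
  · simp only [simplexMap_coord_of_notMem σ _ hv, mul_zero, add_zero]

/-- The straight path from `p` to `q` in a common simplex `σ`. -/
noncomputable def segment (σ : K.faces) {p q : GeomRealization K} (hp : p.coord.support ⊆ σ.1)
    (hq : q.coord.support ⊆ σ.1) : Path p q :=
  ((line (exists_simplexMap_eq σ hp).choose (exists_simplexMap_eq σ hq).choose).map
    (continuous_simplexMap σ)).cast
      (exists_simplexMap_eq σ hp).choose_spec.symm (exists_simplexMap_eq σ hq).choose_spec.symm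

section Segment

variable (σ τ : K.faces) {p q r : GeomRealization K}

theorem segment_coord (hp : p.coord.support ⊆ σ.1) (hq : q.coord.support ⊆ σ.1)
    (t : unitInterval) (v : V) :
    (segment σ hp hq t).coord v = (1 - t) * p.coord v + t * q.coord v := by
  refine (simplexMap_line_coord σ _ _ t v).trans ?_
  rw [(exists_simplexMap_eq σ hp).choose_spec, (exists_simplexMap_eq σ hq).choose_spec]

theorem segment_eq (hp : p.coord.support ⊆ σ.1) (hq : q.coord.support ⊆ σ.1)
    (hp' : p.coord.support ⊆ τ.1) (hq' : q.coord.support ⊆ τ.1) :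
    segment σ hp hq = segment τ hp' hq' := by
  ext t v
  rw [segment_coord, segment_coord]

theorem segment_self (hp : p.coord.support ⊆ σ.1) : segment σ hp hp = Path.refl p := by
  ext t v
  rw [segment_coord, Path.refl_apply]
  ring

theorem segment_simplexMap (a b : stdSimplex ℝ σ.1) :
    segment σ (support_simplexMap_subset σ a) (support_simplexMap_subset σ b) =
      (line a b).map (continuous_simplexMap σ) := by
  ext t v
  rw [segment_coord]
  exact (simplexMap_line_coord σ a b t v).symm

theorem simplyConnectedSpace_stdSimplex : SimplyConnectedSpace (stdSimplex ℝ σ.1) := by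
  classical
  obtain ⟨v, hv⟩ := (K.isRelLowerSet_faces σ.2).1
  have := (convex_stdSimplex ℝ σ.1).contractibleSpace
    ⟨_, single_mem_stdSimplex ℝ (⟨v, hv⟩ : σ.1)⟩
  infer_instance

theorem segment_trans (hp : p.coord.support ⊆ σ.1) (hq : q.coord.support ⊆ σ.1)
    (hr : r.coord.support ⊆ σ.1) :
    ⟦segment σ hp hq⟧ₕ.trans ⟦segment σ hq hr⟧ₕ = ⟦segment σ hp hr⟧ₕ := by
  obtain ⟨a, rfl⟩ := exists_simplexMap_eq σ hp
  obtain ⟨b, rfl⟩ := exists_simplexMap_eq σ hq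
  obtain ⟨c, rfl⟩ := exists_simplexMap_eq σ hr
  have := simplyConnectedSpace_stdSimplex σ
  rw [segment_simplexMap, segment_simplexMap, segment_simplexMap,
    ← Path.Homotopic.Quotient.mk_trans, ← Path.map_trans]
  exact Path.Homotopic.Quotient.eq.2 ((SimplyConnectedSpace.paths_homotopic
    ((line a b).trans (line b c)) (line a c)).map ⟨_, continuous_simplexMap σ⟩)

end Segment

/-! ### Open stars -/

theorem continuous_coord (v : V) : Continuous fun p : GeomRealization K => p.coord v := by
  refine continuous_iSup_dom.2 fun σ => continuous_coinduced_dom.2 ?_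
  by_cases hv : v ∈ σ.1
  · simp only [Function.comp_def, simplexMap_coord σ _ ⟨v, hv⟩]
    exact (continuous_apply (⟨v, hv⟩ : σ.1)).comp continuous_subtype_val
  · simp only [Function.comp_def, simplexMap_coord_of_notMem σ _ hv]
    exact continuous_const

/-- The open star of the vertex `v`. -/
def openStar (K : AbstractSimplicialComplex V) (v : V) : Set (GeomRealization K) :=
  {p | 0 < p.coord v}

theorem isOpen_openStar (v : V) : IsOpen (openStar K v) :=
  isOpen_lt continuous_const (continuous_coord v)

theorem mem_openStar_iff {p : GeomRealization K} {v : V} :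
    p ∈ openStar K v ↔ v ∈ p.coord.support :=
  (p.nonneg v).lt_iff_ne'.trans Finsupp.mem_support_iff.symm

theorem exists_mem_openStar (p : GeomRealization K) : ∃ v, p ∈ openStar K v := by
  obtain ⟨v, hv⟩ := (K.isRelLowerSet_faces p.support_mem).1
  exact ⟨v, mem_openStar_iff.2 hv⟩

theorem support_vertex (v : V) : (vertex K v).coord.support = {v} :=
  Finsupp.support_single v one_ne_zero

theorem support_vertex_subset {v : V} {σ : Finset V} (h : v ∈ σ) :
    (vertex K v).coord.support ⊆ σ := by
  rwa [support_vertex, Finset.singleton_subset_iff]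

theorem vertex_mem_openStar_iff {v w : V} : vertex K v ∈ openStar K w ↔ w = v := by
  rw [mem_openStar_iff, support_vertex, Finset.mem_singleton]

theorem vertex_mem_openStar (v : V) : vertex K v ∈ openStar K v :=
  vertex_mem_openStar_iff.2 rfl

/-- The simplex carrying a point. -/
abbrev carrier (p : GeomRealization K) : K.faces := ⟨p.coord.support, p.support_mem⟩

/-- The straight path from a point of the open star of `v` to `v`. -/
noncomputable def starPath {v : V} {p : GeomRealization K} (hp : p ∈ openStar K v) :
    Path p (vertex K v) :=
  segment (carrier p) subset_rfl (support_vertex_subset (mem_openStar_iff.1 hp))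

section StarPath

variable {v : V} {p q : GeomRealization K}

theorem starPath_mem_openStar (hp : p ∈ openStar K v) (t : unitInterval) :
    starPath hp t ∈ openStar K v := by
  have hv := vertex_mem_openStar (K := K) v
  change 0 < (starPath hp t).coord v
  rw [starPath, segment_coord]
  rcases t.2.1.eq_or_lt with ht | ht
  · rw [← ht]
    simpa using show 0 < p.coord v from hp
  · exact add_pos_of_nonneg_of_pos (mul_nonneg (by linarith [t.2.2]) hp.le) (mul_pos ht hv)

theorem starPath_vertex (h : vertex K v ∈ openStar K v) : starPath h = Path.refl _ :=
  segment_self _ _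

theorem continuous_starPath (v : V) :
    Continuous fun p : openStar K v => (starPath p.2 : C(unitInterval, GeomRealization K)) := by
  refine continuous_of_isOpen (isOpen_openStar v) fun σ => ?_
  by_cases hv : v ∈ σ.1
  · obtain ⟨b, hb⟩ := exists_simplexMap_eq σ (support_vertex_subset (K := K) hv)
    let F : C(stdSimplex ℝ σ.1, C(unitInterval, GeomRealization K)) :=
      ContinuousMap.curry ⟨_, (continuous_simplexMap σ).comp (continuous_line b)⟩
    refine (F.continuous.comp continuous_subtype_val).congr fun a => ?_
    ext t w
    refine (simplexMap_line_coord σ a b t w).trans (Eq.symm ?_)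
    change (starPath a.2 t).coord w = _
    rw [hb, starPath, segment_coord]
  · have : IsEmpty (simplexMap K σ ⁻¹' openStar K v) := ⟨fun a =>
      (simplexMap_coord_of_notMem σ a.1 hv).not_gt a.2⟩
    exact continuous_of_const fun a => isEmptyElim a

theorem mk_trans_mk_starPath (γ : Path p q) (hγ : ∀ t, γ t ∈ openStar K v)
    (hp : p ∈ openStar K v) (hq : q ∈ openStar K v) :
    ⟦γ⟧ₕ.trans ⟦starPath hq⟧ₕ = ⟦starPath hp⟧ₕ := by
  let H : ContinuousMap.Homotopy (⟨Subtype.val, continuous_subtype_val⟩ :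
      C(openStar K v, GeomRealization K)) (ContinuousMap.const _ (vertex K v)) :=
    { toFun x := starPath x.2.2 x.1
      continuous_toFun := by
        have h : Continuous fun x : unitInterval × openStar K v =>
            ((starPath x.2.2 : C(unitInterval, GeomRealization K)), x.1) :=
          ((continuous_starPath v).comp continuous_snd).prodMk continuous_fst
        exact continuous_eval.comp h
      map_zero_left x := (starPath x.2).source
      map_one_left x := (starPath x.2).target }
  let γ' : Path (⟨p, hp⟩ : openStar K v) ⟨q, hq⟩ :=
    { toFun t := ⟨γ t, hγ t⟩
      continuous_toFun := by fun_prop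
      source' := Subtype.ext γ.source
      target' := Subtype.ext γ.target }
  have h : ⟦γ⟧ₕ.trans ⟦starPath hq⟧ₕ =
      ⟦starPath hp⟧ₕ.trans (Path.Homotopic.Quotient.refl (vertex K v)) :=
    Path.Homotopic.Quotient.eq.2 (Path.Homotopic.map_trans_evalAt H γ')
  rw [h, Path.Homotopic.Quotient.trans_refl]

end StarPath

/-! ### Edge paths -/

/-- The vertices `v` and `w` lie in a common simplex; `v = w` is allowed. -/
def Adjacent (K : AbstractSimplicialComplex V) (v w : V) : Prop :=
  ∃ σ : K.faces, v ∈ σ.1 ∧ w ∈ σ.1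

/-- The class of the straight path between two vertices of a simplex. -/
noncomputable def edge {v w : V} (h : Adjacent K v w) : PathClass (vertex K v) (vertex K w) :=
  ⟦segment h.choose (support_vertex_subset h.choose_spec.1)
    (support_vertex_subset h.choose_spec.2)⟧ₕ

theorem edge_eq_segment {v w : V} (h : Adjacent K v w) (σ : K.faces) (hv : v ∈ σ.1)
    (hw : w ∈ σ.1) :
    edge h = ⟦segment σ (support_vertex_subset hv) (support_vertex_subset hw)⟧ₕ := by
  rw [edge, segment_eq]

theorem edge_trans {u v w : V} (σ : K.faces) (hu : u ∈ σ.1) (hv : v ∈ σ.1) (hw : w ∈ σ.1)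
    (huv : Adjacent K u v) (hvw : Adjacent K v w) (huw : Adjacent K u w) :
    (edge huv).trans (edge hvw) = edge huw := by
  rw [edge_eq_segment _ σ hu hv, edge_eq_segment _ σ hv hw, edge_eq_segment _ σ hu hw,
    segment_trans]

theorem edge_self {v : V} (h : Adjacent K v v) :
    edge h = Path.Homotopic.Quotient.refl (vertex K v) := by
  rw [edge, segment_self, Path.Homotopic.Quotient.mk_refl]

theorem edge_map_inclusion {L : AbstractSimplicialComplex V} (hKL : K.faces ⊆ L.faces) {v w : V}
    (h : Adjacent K v w) (h' : Adjacent L v w) : (edge h).map (inclusion hKL) = edge h' := by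
  obtain ⟨σ, hv, hw⟩ := id h
  have hσ : σ.1 ∈ L.faces := hKL σ.2
  rw [edge_eq_segment h σ hv hw, edge_eq_segment h' ⟨σ.1, hσ⟩ hv hw,
    ← Path.Homotopic.Quotient.mk_map]
  refine congrArg Path.Homotopic.Quotient.mk ?_
  ext t u
  exact (segment_coord σ (support_vertex_subset hv) (support_vertex_subset hw) t u).trans
    (segment_coord (K := L) ⟨σ.1, hσ⟩ (support_vertex_subset hv) (support_vertex_subset hw) t
      u).symm

theorem joined_vertex {p : GeomRealization K} {v : V} (hp : p ∈ openStar K v) :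
    Joined p (vertex K v) := ⟨starPath hp⟩

theorem Adjacent.joined {v w : V} (h : Adjacent K v w) : Joined (vertex K v) (vertex K w) :=
  ⟨segment h.choose (support_vertex_subset h.choose_spec.1)
    (support_vertex_subset h.choose_spec.2)⟩

theorem adjacent_of_mem_openStar {v w : V} {p : GeomRealization K} (hv : p ∈ openStar K v)
    (hw : p ∈ openStar K w) : Adjacent K v w :=
  ⟨carrier p, mem_openStar_iff.1 hv, mem_openStar_iff.1 hw⟩

theorem Adjacent.exists_mem_openStar {v w : V} (h : Adjacent K v w) :
    ∃ p, p ∈ openStar K v ∧ p ∈ openStar K w := by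
  obtain ⟨σ, hv, hw⟩ := h
  let m := segment σ (support_vertex_subset hv) (support_vertex_subset hw)
    ⟨1 / 2, by norm_num, by norm_num⟩
  have hm : ∀ u, m.coord u = 1 / 2 * (vertex K v).coord u + 1 / 2 * (vertex K w).coord u :=
    fun u => (segment_coord _ _ _ _ u).trans (by norm_num)
  refine ⟨m, ?_, ?_⟩
  · change 0 < m.coord v
    have h₁ : 0 < (vertex K v).coord v := vertex_mem_openStar v
    have h₂ := (vertex K w).nonneg v
    rw [hm]
    positivity
  · change 0 < m.coord w
    have h₁ : 0 < (vertex K w).coord w := vertex_mem_openStar w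
    have h₂ := (vertex K v).nonneg w
    rw [hm]
    positivity

theorem mk_starPath_trans_edge {v w : V} {p : GeomRealization K} (hv : p ∈ openStar K v)
    (hw : p ∈ openStar K w) (h : Adjacent K v w) :
    ⟦starPath hv⟧ₕ.trans (edge h) = ⟦starPath hw⟧ₕ := by
  rw [starPath, edge_eq_segment h (carrier p) (mem_openStar_iff.1 hv) (mem_openStar_iff.1 hw),
    segment_trans, ← starPath]

theorem edge_induction {P : ∀ v w : V, PathClass (vertex K v) (vertex K w) → Prop}
    (trans : ∀ {u v w : V} (p : PathClass (vertex K u) (vertex K v))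
      (q : PathClass (vertex K v) (vertex K w)), P u v p → P v w q → P u w (p.trans q))
    (of_edge : ∀ {v w : V} (h : Adjacent K v w), P v w (edge h)) {v w : V}
    (q : PathClass (vertex K v) (vertex K w)) : P v w q := by
  have h_pushed : ∀ {x y : GeomRealization K} (q : PathClass x y) {v w : V}
      (hv : x ∈ openStar K v) (hw : y ∈ openStar K w),
      P v w (⟦starPath hv⟧ₕ.symm.trans (q.trans ⟦starPath hw⟧ₕ)) := by
    intro x y q
    refine PathClass.local_induction (P := fun x y q => ∀ {v w : V} (hv : x ∈ openStar K v)
      (hw : y ∈ openStar K w), P v w (⟦starPath hv⟧ₕ.symm.trans (q.trans ⟦starPath hw⟧ₕ)))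
      (fun {x y z} p q hp hq v w hv hw => ?_) (fun z => ?_) q
    · obtain ⟨u, hu⟩ := exists_mem_openStar y
      simpa only [Path.Homotopic.Quotient.trans_assoc, PathClass.trans_symm_cancel_left]
        using trans _ _ (hp hv hu) (hq hu hw)
    · obtain ⟨u, hu⟩ := exists_mem_openStar z
      refine ⟨_, (isOpen_openStar u).mem_nhds hu, fun {x y} γ hγ v w hv hw => ?_⟩
      have hx : x ∈ openStar K u := by simpa using hγ 0
      have hy : y ∈ openStar K u := by simpa using hγ 1
      have hvu := adjacent_of_mem_openStar hv hx
      have huw := adjacent_of_mem_openStar hy hw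
      rw [← mk_starPath_trans_edge hy hw huw, ← Path.Homotopic.Quotient.trans_assoc ⟦γ⟧ₕ,
        mk_trans_mk_starPath γ hγ hx hy, ← mk_starPath_trans_edge hv hx hvu,
        Path.Homotopic.Quotient.trans_assoc, PathClass.symm_trans_cancel_left]
      exact trans _ _ (of_edge hvu) (of_edge huw)
  have h := h_pushed q (vertex_mem_openStar v) (vertex_mem_openStar w)
  rwa [starPath_vertex, starPath_vertex, ← Path.Homotopic.Quotient.mk_symm, Path.refl_symm,
    Path.Homotopic.Quotient.mk_refl, Path.Homotopic.Quotient.mk_refl,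
    Path.Homotopic.Quotient.trans_refl, Path.Homotopic.Quotient.refl_trans] at h

theorem pathHom_eq_of_eq_on_edges {G : Type*} [Group G] {φ ψ : PathHom (GeomRealization K) G}
    (h : ∀ {v w : V} (e : Adjacent K v w), φ (edge e) = ψ (edge e)) {v w : V}
    (q : PathClass (vertex K v) (vertex K w)) : φ q = ψ q :=
  edge_induction (P := fun _ _ q => φ q = ψ q)
    (fun p q hp hq => by rw [φ.map_trans, ψ.map_trans, hp, hq]) h q

section EdgeCocycle

variable {G : Type*} [Group G] (g : V → V → G)
  (hg : ∀ (σ : K.faces) (u v w : V), u ∈ σ.1 → v ∈ σ.1 → w ∈ σ.1 → g v w * g u v = g u w)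

/-- A cocycle on the edges of `K`, as a cocycle on the cover by open stars. -/
noncomputable def starCocycle : LocallyConstantCocycle (GeomRealization K) V G where
  cover := openStar K
  isOpen_cover := isOpen_openStar
  index p := (exists_mem_openStar p).choose
  mem_cover_index p := (exists_mem_openStar p).choose_spec
  trans := g
  trans_mul_trans i j k := fun ⟨p, ⟨hi, hj⟩, hk⟩ => hg (carrier p) i j k
    (mem_openStar_iff.1 hi) (mem_openStar_iff.1 hj) (mem_openStar_iff.1 hk)

theorem holonomy_starPath {p : GeomRealization K} {v : V} (hp : p ∈ openStar K v) :
    (starCocycle g hg).holonomy ⟦starPath hp⟧ₕ = g ((starCocycle g hg).index p) v := by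
  have h_index : (starCocycle g hg).index (vertex K v) = v :=
    vertex_mem_openStar_iff.1 ((starCocycle g hg).mem_cover_index (vertex K v))
  rw [LocallyConstantCocycle.holonomy_mk (starCocycle g hg) _ (starPath_mem_openStar hp), h_index,
    (starCocycle g hg).trans_self ⟨p, hp⟩, one_mul]
  rfl

theorem holonomy_edge {v w : V} (h : Adjacent K v w) :
    (starCocycle g hg).holonomy (edge h) = g v w := by
  obtain ⟨m, hv, hw⟩ := h.exists_mem_openStar
  have h_cocycle := (starCocycle g hg).trans_mul_trans ((starCocycle g hg).index m) v w
    ⟨m, ⟨(starCocycle g hg).mem_cover_index m, hv⟩, hw⟩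
  have h_edge := congrArg (starCocycle g hg).holonomy.toFun (mk_starPath_trans_edge hv hw h)
  rw [PathHom.map_trans, holonomy_starPath, holonomy_starPath] at h_edge
  exact mul_right_cancel (h_edge.trans h_cocycle.symm)

end EdgeCocycle

end GeomRealization

/-! ### Lengths of path classes -/

theorem lipschitzWith_ite_le {X : Type*} [PseudoMetricSpace X] {K : NNReal} {f g : ℝ → X}
    (hf : LipschitzWith K f) (hg : LipschitzWith K g) {a : ℝ} (h : f a = g a) :
    LipschitzWith K fun u => if u ≤ a then f u else g u := by
  have h_le : ∀ s t : ℝ, s ≤ t →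
      dist (if s ≤ a then f s else g s) (if t ≤ a then f t else g t) ≤ K * dist s t := by
    intro s t hst
    by_cases ht : t ≤ a
    · rw [if_pos (hst.trans ht), if_pos ht]
      exact hf.dist_le_mul s t
    · by_cases hs : s ≤ a
      · rw [if_pos hs, if_neg ht]
        calc dist (f s) (g t) ≤ dist (f s) (f a) + dist (g a) (g t) := h ▸ dist_triangle _ _ _
          _ ≤ K * dist s a + K * dist a t := add_le_add (hf.dist_le_mul _ _) (hg.dist_le_mul _ _)
          _ = K * dist s t := by
            rw [Real.dist_eq, Real.dist_eq, Real.dist_eq, abs_of_nonpos (by linarith),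
              abs_of_nonpos (by linarith), abs_of_nonpos (by linarith)]
            ring
      · rw [if_neg hs, if_neg ht]
        exact hg.dist_le_mul s t
  refine LipschitzWith.of_dist_le_mul fun s t => ?_
  rcases le_total s t with hst | hst
  · exact h_le s t hst
  · simpa only [dist_comm] using h_le t s hst

theorem exists_lipschitzWith_append {X : Type*} [PseudoMetricSpace X] {K : NNReal} {f g : ℝ → X}
    (hf : LipschitzWith K f) (hg : LipschitzWith K g) {a : ℝ} (h : f a = g 0) :
    ∃ k : ℝ → X, LipschitzWith K k ∧ (∀ u ≤ a, k u = f u) ∧ ∀ u ≥ 0, k (a + u) = g u := by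
  refine ⟨fun u => if u ≤ a then f u else g (u - a), lipschitzWith_ite_le hf
    (g := fun u => g (u - a)) (LipschitzWith.of_dist_le_mul fun s t => ?_) (by simpa using h),
    fun u hu => if_pos hu, fun u hu => ?_⟩
  · simpa using hg.dist_le_mul (s - a) (t - a)
  · rcases hu.eq_or_lt with rfl | hu
    · simpa using h
    · simp only [if_neg (not_le.2 (lt_add_of_pos_right a hu)), add_sub_cancel_left]

namespace PathClass

variable {X : Type*} [TopologicalSpace X] {x y z : X}

theorem cast_trans_cast {x' y' z' : X} (p : PathClass x y) (q : PathClass y z) (hx : x' = x)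
    (hy : y' = y) (hz : z' = z) :
    (p.cast hx hy).trans (q.cast hy hz) = (p.trans q).cast hx hz := by
  subst hx hy hz
  simp only [Path.Homotopic.Quotient.cast_rfl_rfl]

theorem mk_eq_trans_of_subpath {ε : Path x z} {γ : Path x y} {δ : Path y z} (a : unitInterval)
    (hγ : ∀ t, ε.subpath 0 a t = γ t) (hδ : ∀ t, ε.subpath a 1 t = δ t) :
    ⟦ε⟧ₕ = ⟦γ⟧ₕ.trans ⟦δ⟧ₕ := by
  have ha : y = ε a := by simpa using (hγ 1).symm
  have hγ' : γ = (ε.subpath 0 a).cast ε.source.symm ha := by ext t; exact (hγ t).symm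
  have hδ' : δ = (ε.subpath a 1).cast ha ε.target.symm := by ext t; exact (hδ t).symm
  rw [hγ', hδ', Path.Homotopic.Quotient.mk_cast, Path.Homotopic.Quotient.mk_cast,
    cast_trans_cast, mk_subpath_trans, Path.subpath_zero_one, Path.Homotopic.Quotient.mk_cast,
    Path.Homotopic.Quotient.cast_cast, Path.Homotopic.Quotient.cast_rfl_rfl]

end PathClass

section Length

variable {X : Type*} [MetricSpace X] {x y z : X}

theorem dist_zero_left_unitInterval (t : unitInterval) : dist 0 t = (t : ℝ) := by
  rw [Subtype.dist_eq, Real.dist_eq, abs_sub_comm]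
  simpa using t.2.1

theorem exists_lipschitzWith_one_mul {γ : Path x y} {L : ℝ}
    (hγ : ∀ s t, dist (γ s) (γ t) ≤ L * dist s t) :
    ∃ f : ℝ → X, LipschitzWith 1 f ∧ ∀ t : unitInterval, f (L * t) = γ t := by
  have hL : 0 ≤ L := by simpa [dist_zero_left_unitInterval] using dist_nonneg.trans (hγ 0 1)
  rcases hL.eq_or_lt with rfl | hL
  · refine ⟨fun _ => x, LipschitzWith.const' x, fun t => ?_⟩
    simpa using hγ 0 t
  refine ⟨fun u => γ.extend (u / L), LipschitzWith.mk_one fun s t => ?_, fun t => ?_⟩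
  · calc dist (γ.extend (s / L)) (γ.extend (t / L))
        ≤ L * dist (Set.projIcc (0 : ℝ) 1 zero_le_one (s / L))
            (Set.projIcc (0 : ℝ) 1 zero_le_one (t / L)) := hγ _ _
      _ ≤ L * dist (s / L) (t / L) :=
          mul_le_mul_of_nonneg_left
            (by simpa using (LipschitzWith.projIcc zero_le_one).dist_le_mul (s / L) (t / L)) hL.le
      _ = dist s t := by
          rw [Real.dist_eq, Real.dist_eq, ← sub_div, abs_div, abs_of_pos hL,
            mul_div_cancel₀ _ hL.ne']
  · simp only [mul_div_cancel_left₀ _ hL.ne', Path.extend_apply _ t.2]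

/-- The path class `q` has a representative of length at most `L`, encoded as a path on the unit
interval with Lipschitz constant `L`. -/
def HasLengthLE (q : PathClass x y) (L : ℝ) : Prop :=
  ∃ γ : Path x y, (∀ s t, dist (γ s) (γ t) ≤ L * dist s t) ∧ ⟦γ⟧ₕ = q

namespace HasLengthLE

variable {p : PathClass x y} {L M : ℝ}

theorem dist_le (h : HasLengthLE p L) : dist x y ≤ L := by
  obtain ⟨γ, hγ, -⟩ := h
  simpa [dist_zero_left_unitInterval] using hγ 0 1

theorem nonneg (h : HasLengthLE p L) : 0 ≤ L :=
  dist_nonneg.trans h.dist_le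

theorem mono (h : HasLengthLE p L) (hL : L ≤ M) : HasLengthLE p M := by
  obtain ⟨γ, hγ, e⟩ := h
  exact ⟨γ, fun s t => (hγ s t).trans (mul_le_mul_of_nonneg_right hL dist_nonneg), e⟩

theorem symm (h : HasLengthLE p L) : HasLengthLE p.symm L := by
  obtain ⟨γ, hγ, rfl⟩ := h
  refine ⟨γ.symm, fun s t => (hγ _ _).trans_eq ?_, rfl⟩
  congr 1
  simp only [Subtype.dist_eq, unitInterval.coe_symm_eq, dist_sub_left]

theorem cast (h : HasLengthLE p L) {x' y' : X} (hx : x' = x) (hy : y' = y) :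
    HasLengthLE (p.cast hx hy) L := by
  subst hx hy
  rwa [Path.Homotopic.Quotient.cast_rfl_rfl]

theorem trans {q : PathClass y z} (hp : HasLengthLE p L) (hq : HasLengthLE q M) :
    HasLengthLE (p.trans q) (L + M) := by
  have hL := hp.nonneg
  have hM := hq.nonneg
  obtain ⟨γ, hγ, rfl⟩ := hp
  obtain ⟨δ, hδ, rfl⟩ := hq
  obtain ⟨f, hf, hfγ⟩ := exists_lipschitzWith_one_mul hγ
  obtain ⟨g, hg, hgδ⟩ := exists_lipschitzWith_one_mul hδ
  obtain ⟨h, h_lip, h_le, h_add⟩ := exists_lipschitzWith_append hf hg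
    (show f L = g 0 by rw [show f L = y by simpa using hfγ 1, show g 0 = y by simpa using hgδ 0])
  have h_left : ∀ t : unitInterval, h (L * t) = γ t := fun t => by
    rw [← hfγ, h_le _ (mul_le_of_le_one_right hL t.2.2)]
  have h_right : ∀ t : unitInterval, h (L + M * t) = δ t := fun t => by
    rw [← hgδ, h_add _ (mul_nonneg hM t.2.1)]
  let ε : Path x z :=
    { toFun := fun t => h ((L + M) * t)
      continuous_toFun := h_lip.continuous.comp (by fun_prop)
      source' := by simpa using h_left 0
      target' := by simpa using h_right 1 }
  have ha : (L + M) * (L / (L + M)) = L := by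
    rcases (add_nonneg hL hM).eq_or_lt with h0 | h0
    · rw [← h0, zero_mul]; linarith
    · exact mul_div_cancel₀ _ h0.ne'
  let a : unitInterval :=
    ⟨L / (L + M), by positivity, div_le_one_of_le₀ (by linarith) (by linarith)⟩
  refine ⟨ε, fun s t => ?_, PathClass.mk_eq_trans_of_subpath a (fun t => ?_) fun t => ?_⟩
  · refine (h_lip.dist_le_mul _ _).trans_eq ?_
    rw [NNReal.coe_one, one_mul, Real.dist_eq, ← mul_sub, abs_mul, abs_of_nonneg (by linarith)]
    rfl
  · rw [← h_left]
    change h _ = _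
    congr 1
    rw [Set.Icc.coe_convexComb]
    simp only [Set.Icc.coe_zero, a]
    linear_combination (t : ℝ) * ha
  · rw [← h_right]
    change h _ = _
    congr 1
    rw [Set.Icc.coe_convexComb]
    simp only [Set.Icc.coe_one, a]
    linear_combination (1 - t : ℝ) * ha

theorem subpath {γ : Path x y} (hγ : ∀ s t, dist (γ s) (γ t) ≤ L * dist s t)
    (s t : unitInterval) : HasLengthLE ⟦γ.subpath s t⟧ₕ (L * dist s t) := by
  refine ⟨γ.subpath s t, fun u v => (hγ _ _).trans_eq ?_, rfl⟩
  rw [mul_assoc]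
  congr 1
  simp only [Subtype.dist_eq, Real.dist_eq, Set.Icc.coe_convexComb, ← abs_mul]
  rw [← abs_neg]
  congr 1
  ring

end HasLengthLE

end Length

/-! ### Geodesics and small paths -/

section Geodesic

variable {X : Type*} [MetricSpace X]

theorem IsGeodesicSpace.exists_path (hgeo : IsGeodesicSpace X) (x y : X) :
    ∃ γ : Path x y, ∀ s t, dist (γ s) (γ t) = dist x y * dist s t := by
  obtain ⟨f, h0, h1, h⟩ := hgeo x y
  have h_mem : ∀ t : unitInterval, dist x y * t ∈ Set.Icc (0 : ℝ) (dist x y) := fun t =>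
    ⟨mul_nonneg dist_nonneg t.2.1, mul_le_of_le_one_right dist_nonneg t.2.2⟩
  have h_dist : ∀ s t : unitInterval, dist (f (dist x y * s)) (f (dist x y * t)) =
      dist x y * dist s t := fun s t => by
    rw [h _ (h_mem s) _ (h_mem t), ← mul_sub, abs_mul, abs_of_nonneg dist_nonneg]
    rfl
  have h_lip : LipschitzWith ⟨dist x y, dist_nonneg⟩ fun t : unitInterval => f (dist x y * t) :=
    LipschitzWith.of_dist_le_mul fun s t => (h_dist s t).le
  exact ⟨⟨⟨_, h_lip.continuous⟩, by simp [h0], by simp [h1]⟩, h_dist⟩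

/-- A chosen minimizing geodesic from `x` to `y`, with constant speed. -/
noncomputable def IsGeodesicSpace.geodesic (hgeo : IsGeodesicSpace X) (x y : X) : Path x y :=
  (hgeo.exists_path x y).choose

namespace IsGeodesicSpace

variable (hgeo : IsGeodesicSpace X)

theorem dist_geodesic (x y : X) (s t : unitInterval) :
    dist (hgeo.geodesic x y s) (hgeo.geodesic x y t) = dist x y * dist s t :=
  (hgeo.exists_path x y).choose_spec s t

theorem dist_left_geodesic_le (x y : X) (t : unitInterval) :
    dist x (hgeo.geodesic x y t) ≤ dist x y := by
  have h := hgeo.dist_geodesic x y 0 t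
  rw [Path.source, dist_zero_left_unitInterval] at h
  exact h.trans_le (mul_le_of_le_one_right dist_nonneg t.2.2)

/-- The class of the chosen minimizing geodesic from `x` to `y`. -/
noncomputable def geodesicClass (x y : X) : PathClass x y :=
  ⟦hgeo.geodesic x y⟧ₕ

theorem hasLengthLE_geodesicClass (x y : X) : HasLengthLE (hgeo.geodesicClass x y) (dist x y) :=
  ⟨hgeo.geodesic x y, fun s t => (hgeo.dist_geodesic x y s t).le, rfl⟩

theorem geodesicClass_self (x : X) :
    hgeo.geodesicClass x x = Path.Homotopic.Quotient.refl x := by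
  have h : hgeo.geodesic x x = Path.refl x := by
    ext t
    exact (dist_le_zero.1 ((hgeo.dist_left_geodesic_le x x t).trans_eq (dist_self x))).symm
  rw [geodesicClass, h, Path.Homotopic.Quotient.mk_refl]

end IsGeodesicSpace

end Geodesic

theorem forall_trans_mem {X : Type*} [TopologicalSpace X] {x y z : X} {γ : Path x y}
    {δ : Path y z} {U : Set X} (hγ : ∀ t, γ t ∈ U) (hδ : ∀ t, δ t ∈ U) (t : unitInterval) :
    γ.trans δ t ∈ U := by
  have : γ.trans δ t ∈ Set.range γ ∪ Set.range δ := γ.trans_range δ ▸ Set.mem_range_self t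
  rcases this with ⟨s, hs⟩ | ⟨s, hs⟩
  · exact hs ▸ hγ s
  · exact hs ▸ hδ s

theorem PathClass.mk_eq_of_forall_loop {X : Type*} [TopologicalSpace X] {U : Set X} {w : X}
    (hU : ∀ x ∈ U, JoinedIn U w x)
    (hw : ∀ γ : Path w w, Set.range γ ⊆ U → γ.Homotopic (Path.refl w)) {x y : X}
    {γ γ' : Path x y} (hγ : ∀ t, γ t ∈ U) (hγ' : ∀ t, γ' t ∈ U) : ⟦γ⟧ₕ = ⟦γ'⟧ₕ := by
  obtain ⟨η, hη⟩ := hU x (by simpa using hγ 0)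
  have h_loop : ∀ t, (η.trans (γ.trans γ'.symm)).trans η.symm t ∈ U :=
    forall_trans_mem (forall_trans_mem hη (forall_trans_mem hγ fun _ => hγ' _)) fun _ => hη _
  have h_null := Path.Homotopic.Quotient.eq.2 (hw _ (Set.range_subset_iff.2 h_loop))
  simp only [Path.Homotopic.Quotient.mk_trans, Path.Homotopic.Quotient.mk_symm,
    Path.Homotopic.Quotient.mk_refl] at h_null
  rwa [PathClass.conj_eq_refl_iff, PathClass.trans_symm_eq_refl_iff] at h_null

/-- Two paths with the same endpoints which lie in a common ball of radius `R` are homotopic in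
`X`. This is the uniform form that semi-local simple connectedness takes on compact geodesic
spaces. -/
structure IsSLSCRadius (X : Type*) [MetricSpace X] (R : ℝ) : Prop where
  pos : 0 < R
  mk_eq : ∀ (z : X) {x y : X} (γ γ' : Path x y), (∀ t, γ t ∈ Metric.ball z R) →
    (∀ t, γ' t ∈ Metric.ball z R) → ⟦γ⟧ₕ = ⟦γ'⟧ₕ

section SLSCRadius

variable {X : Type*} [MetricSpace X]

theorem IsSLSC.exists_isSLSCRadius [CompactSpace X] (hslsc : IsSLSC X)
    (hgeo : IsGeodesicSpace X) : ∃ R, IsSLSCRadius X R := by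
  have h_ball : ∀ x : X, ∃ ε > 0, ∀ γ : Path x x, Set.range γ ⊆ Metric.ball x ε →
      γ.Homotopic (Path.refl x) := fun x => by
    obtain ⟨U, hU, h⟩ := hslsc.2 x
    obtain ⟨ε, hε, hb⟩ := Metric.mem_nhds_iff.1 hU
    exact ⟨ε, hε, fun γ hγ => h γ (hγ.trans hb)⟩
  choose ε hε h_null using h_ball
  obtain ⟨R, hR, h_leb⟩ := lebesgue_number_lemma_of_metric (isCompact_univ (X := X))
    (c := fun x => Metric.ball x (ε x)) (fun x => Metric.isOpen_ball)
    (fun x _ => Set.mem_iUnion.2 ⟨x, Metric.mem_ball_self (hε x)⟩)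
  refine ⟨R, hR, fun z x y γ γ' hγ hγ' => ?_⟩
  obtain ⟨w, hw⟩ := h_leb z trivial
  refine PathClass.mk_eq_of_forall_loop (fun x hx => ⟨hgeo.geodesic w x, fun t => ?_⟩) (h_null w)
    (fun t => hw (hγ t)) fun t => hw (hγ' t)
  exact Metric.mem_ball'.2 ((hgeo.dist_left_geodesic_le w x t).trans_lt (Metric.mem_ball'.1 hx))

namespace IsSLSCRadius

variable {R : ℝ} (hR : IsSLSCRadius X R) (hgeo : IsGeodesicSpace X)
include hR

theorem mk_eq_geodesicClass {x y : X} (γ : Path x y) (h : ∀ t, dist x (γ t) < R) :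
    ⟦γ⟧ₕ = hgeo.geodesicClass x y :=
  hR.mk_eq x _ _ (fun t => Metric.mem_ball'.2 (h t)) fun t =>
    Metric.mem_ball'.2 ((hgeo.dist_left_geodesic_le x y t).trans_lt (by simpa using h 1))

include hgeo

theorem geodesic_induction {P : ∀ x y : X, PathClass x y → Prop}
    (trans : ∀ {x y z : X} (p : PathClass x y) (q : PathClass y z),
      P x y p → P y z q → P x z (p.trans q))
    (geodesicClass : ∀ x y : X, dist x y < R → P x y (hgeo.geodesicClass x y))
    {x y : X} (q : PathClass x y) : P x y q := by
  induction q using PathClass.local_induction with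
  | trans p q hp hq => exact trans p q hp hq
  | small z =>
    refine ⟨Metric.ball z (R / 2), Metric.ball_mem_nhds z (half_pos hR.pos), fun {x y} γ hγ => ?_⟩
    have h_dist : ∀ t, dist x (γ t) < R := fun t => by
      have h_zero := hγ 0
      rw [Path.source] at h_zero
      exact (dist_triangle_right x (γ t) z).trans_lt
        ((add_lt_add h_zero (hγ t)).trans_eq (add_halves R))
    rw [hR.mk_eq_geodesicClass hgeo γ h_dist]
    exact geodesicClass x y (by simpa using h_dist 1)

theorem exists_hasLengthLE {x y : X} (q : PathClass x y) : ∃ L, HasLengthLE q L := by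
  induction q using hR.geodesic_induction hgeo with
  | trans p q hp hq =>
    obtain ⟨L, hL⟩ := hp
    obtain ⟨M, hM⟩ := hq
    exact ⟨L + M, hL.trans hM⟩
  | geodesicClass x y _ => exact ⟨_, hgeo.hasLengthLE_geodesicClass x y⟩

theorem trans_geodesicClass {x y x' y' : X} (γ : Path x y) (γ' : Path x' y')
    (h : ∀ t, dist (γ t) (γ' t) < R / 2) :
    ⟦γ⟧ₕ.trans (hgeo.geodesicClass y y') = (hgeo.geodesicClass x x').trans ⟦γ'⟧ₕ := by
  -- A pair of close paths is a single path in the space of close pairs.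
  let Z := {z : X × X // dist z.1 z.2 < R / 2}
  let f₁ : C(Z, X) := ⟨fun z => z.1.1, by fun_prop⟩
  let f₂ : C(Z, X) := ⟨fun z => z.1.2, by fun_prop⟩
  have h_square : ∀ {a b : Z} (p : PathClass a b),
      (p.map f₁).trans (hgeo.geodesicClass b.1.1 b.1.2) =
        (hgeo.geodesicClass a.1.1 a.1.2).trans (p.map f₂) := by
    intro a b p
    induction p using PathClass.local_induction with
    | trans p q hp hq =>
      rw [PathClass.map_trans, PathClass.map_trans, Path.Homotopic.Quotient.trans_assoc, hq,
        ← Path.Homotopic.Quotient.trans_assoc, hp, Path.Homotopic.Quotient.trans_assoc]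
    | small z =>
      refine ⟨f₁ ⁻¹' Metric.ball z.1.1 (R / 2), f₁.continuous.continuousAt.preimage_mem_nhds
        (Metric.ball_mem_nhds _ (half_pos hR.pos)), fun {a b} δ hδ => ?_⟩
      have h₁ : ∀ t, dist z.1.1 (δ t).1.1 < R / 2 := fun t => Metric.mem_ball'.1 (hδ t)
      have h_geo : ∀ (w : Z) (s : unitInterval), dist z.1.1 w.1.1 < R / 2 →
          hgeo.geodesic w.1.1 w.1.2 s ∈ Metric.ball z.1.1 R := fun w s hw => by
        rw [Metric.mem_ball']
        linarith [dist_triangle z.1.1 w.1.1 (hgeo.geodesic w.1.1 w.1.2 s),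
          hgeo.dist_left_geodesic_le w.1.1 w.1.2 s, w.2]
      refine hR.mk_eq z.1.1 _ _
        (forall_trans_mem (fun t => ?_) fun t => h_geo b t (by simpa using h₁ 1))
        (forall_trans_mem (fun t => h_geo a t (by simpa using h₁ 0)) fun t => ?_)
      · exact Metric.mem_ball'.2 ((h₁ t).trans (half_lt_self hR.pos))
      · have h_end := h_geo (δ t) 1 (h₁ t)
        rw [Path.target] at h_end
        exact h_end
  let γγ' : Path (⟨(x, x'), by simpa using h 0⟩ : Z) ⟨(y, y'), by simpa using h 1⟩ :=
    { toFun t := ⟨(γ t, γ' t), h t⟩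
      source' := by simp
      target' := by simp }
  exact h_square ⟦γγ'⟧ₕ

theorem mk_eq_of_close {x y : X} (γ γ' : Path x y) (h : ∀ t, dist (γ t) (γ' t) < R / 2) :
    ⟦γ⟧ₕ = ⟦γ'⟧ₕ := by
  simpa only [hgeo.geodesicClass_self, Path.Homotopic.Quotient.trans_refl,
    Path.Homotopic.Quotient.refl_trans] using hR.trans_geodesicClass hgeo γ γ' h

theorem map_eq_one_iff_of_close {G : Type*} [Group G] (φ : PathHom X G) {x x' : X}
    (γ : Path x x) (γ' : Path x' x') (h : ∀ t, dist (γ t) (γ' t) < R / 2) :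
    φ ⟦γ⟧ₕ = 1 ↔ φ ⟦γ'⟧ₕ = 1 :=
  φ.map_eq_one_iff_of_trans_eq (hR.trans_geodesicClass hgeo γ γ' h)

end IsSLSCRadius

end SLSCRadius

/-! ### Shortest representatives -/

section Minimizing

variable {X : Type*} [MetricSpace X]

theorem isCompact_setOf_dist_le_mul [CompactSpace X] (α : Type*) [MetricSpace α]
    [CompactSpace α] (L : ℝ) :
    IsCompact {f : C(α, X) | ∀ s t, dist (f s) (f t) ≤ L * dist s t} := by
  have h_bounded : IsCompact
      {f : BoundedContinuousFunction α X | ∀ s t, dist (f s) (f t) ≤ L * dist s t} := by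
    refine BoundedContinuousFunction.arzela_ascoli₁ _ ?_ ?_
    · simp only [Set.ofPred_forall]
      exact isClosed_iInter fun s => isClosed_iInter fun t =>
        isClosed_le (by fun_prop) continuous_const
    · refine Metric.equicontinuous_of_continuity_modulus (fun d => L * d) ?_ _ fun s t f => f.2 s t
      simpa using (continuous_const_mul L).tendsto 0
  exact (ContinuousMap.isometryEquivBoundedOfCompact α X).toHomeomorph.isCompact_preimage.2
    h_bounded

theorem exists_min_dist_le_mul [CompactSpace X] {α : Type*} [MetricSpace α] [CompactSpace α]
    {S : Set C(α, X)} (hS : IsClosed S) {L : ℝ} (hL : 0 ≤ L) {g : C(α, X)} (hg : g ∈ S)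
    (hgL : ∀ s t, dist (g s) (g t) ≤ L * dist s t) :
    ∃ (l : ℝ) (f : C(α, X)), f ∈ S ∧ (∀ s t, dist (f s) (f t) ≤ l * dist s t) ∧
      ∀ (l' : ℝ) (f' : C(α, X)), 0 ≤ l' → f' ∈ S →
        (∀ s t, dist (f' s) (f' t) ≤ l' * dist s t) → l ≤ l' := by
  let T : Set (ℝ × C(α, X)) :=
    {p | p.1 ∈ Set.Icc 0 L ∧ p.2 ∈ S ∧ ∀ s t, dist (p.2 s) (p.2 t) ≤ p.1 * dist s t}
  have hT : IsCompact T := by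
    refine ((isCompact_Icc (a := (0 : ℝ)) (b := L)).prod
      (isCompact_setOf_dist_le_mul (X := X) α L)).of_isClosed_subset ?_ ?_
    · have hc : IsClosed {p : ℝ × C(α, X) | ∀ s t, dist (p.2 s) (p.2 t) ≤ p.1 * dist s t} := by
        simp only [Set.ofPred_forall]
        exact isClosed_iInter fun s => isClosed_iInter fun t =>
          isClosed_le (by fun_prop) (by fun_prop)
      exact (isClosed_Icc.preimage continuous_fst).inter ((hS.preimage continuous_snd).inter hc)
    · rintro ⟨l, f⟩ ⟨hl, -, hf⟩
      exact ⟨hl, fun s t => (hf s t).trans (mul_le_mul_of_nonneg_right hl.2 dist_nonneg)⟩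
  obtain ⟨⟨l, f⟩, ⟨hl, hf, hlf⟩, h_min⟩ :=
    hT.exists_isMinOn ⟨(L, g), ⟨hL, le_rfl⟩, hg, hgL⟩ continuous_fst.continuousOn
  refine ⟨l, f, hf, hlf, fun l' f' hl' hf' hlf' => ?_⟩
  rcases le_total l' L with h | h
  · exact h_min (show (l', f') ∈ T from ⟨⟨hl', h⟩, hf', hlf'⟩)
  · exact hl.2.trans h

namespace IsSLSCRadius

variable {R : ℝ} (hR : IsSLSCRadius X R) (hgeo : IsGeodesicSpace X) {x y : X}
include hR hgeo

theorem isClosed_setOf_mk_eq (q : PathClass x y) :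
    IsClosed {f : C(unitInterval, X) | ∃ γ : Path x y, ⟦γ⟧ₕ = q ∧ γ.toContinuousMap = f} := by
  refine isClosed_of_closure_subset fun f hf => ?_
  have h_ends : f ∈ {f : C(unitInterval, X) | f 0 = x ∧ f 1 = y} := by
    refine closure_minimal ?_ ((isClosed_eq (by fun_prop) continuous_const).inter
      (isClosed_eq (by fun_prop) continuous_const)) hf
    rintro _ ⟨γ, -, rfl⟩
    exact ⟨γ.source, γ.target⟩
  obtain ⟨_, ⟨γ, rfl, rfl⟩, hγ⟩ := Metric.mem_closure_iff.1 hf (R / 2) (half_pos hR.pos)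
  refine ⟨⟨f, h_ends.1, h_ends.2⟩, hR.mk_eq_of_close hgeo _ _ fun t => ?_, rfl⟩
  exact (ContinuousMap.dist_apply_le_dist t).trans_lt hγ

theorem isClosed_setOf_map_ne_one {G : Type*} [Group G] (φ : PathHom X G) :
    IsClosed {f : C(unitInterval, X) |
      ∃ (x : X) (γ : Path x x), φ ⟦γ⟧ₕ ≠ 1 ∧ γ.toContinuousMap = f} := by
  refine isClosed_of_closure_subset fun f hf => ?_
  have h_ends : f ∈ {f : C(unitInterval, X) | f 0 = f 1} := by
    refine closure_minimal ?_ (isClosed_eq (by fun_prop) (by fun_prop)) hf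
    rintro _ ⟨x, γ, -, rfl⟩
    exact γ.source.trans γ.target.symm
  obtain ⟨_, ⟨x, γ, hγ, rfl⟩, hd⟩ := Metric.mem_closure_iff.1 hf (R / 2) (half_pos hR.pos)
  refine ⟨f 0, ⟨f, rfl, h_ends.symm⟩, fun h => hγ ?_, rfl⟩
  refine (hR.map_eq_one_iff_of_close hgeo φ _ γ fun t => ?_).1 h
  exact (ContinuousMap.dist_apply_le_dist t).trans_lt hd

theorem exists_shortest_path [CompactSpace X] (q : PathClass x y) :
    ∃ (l : ℝ) (γ : Path x y), (∀ s t, dist (γ s) (γ t) ≤ l * dist s t) ∧ ⟦γ⟧ₕ = q ∧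
      ∀ l', HasLengthLE q l' → l ≤ l' := by
  obtain ⟨L, hL⟩ := hR.exists_hasLengthLE hgeo q
  have hL_nonneg := hL.nonneg
  obtain ⟨γ₀, h_lip, hγ₀⟩ := hL
  obtain ⟨l, _, ⟨γ, hγ, rfl⟩, hl, h_min⟩ := exists_min_dist_le_mul
    (hR.isClosed_setOf_mk_eq hgeo q) hL_nonneg (g := γ₀.toContinuousMap) ⟨γ₀, hγ₀, rfl⟩ h_lip
  refine ⟨l, γ, hl, hγ, fun l' h' => ?_⟩
  have hl' := h'.nonneg
  obtain ⟨γ', h_lip', hγ'⟩ := h'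
  exact h_min l' γ'.toContinuousMap hl' ⟨γ', hγ', rfl⟩ h_lip'

theorem exists_shortest_loop [CompactSpace X] {G : Type*} [Group G] (φ : PathHom X G)
    {q : PathClass x x} (hφ : φ q ≠ 1) :
    ∃ (l : ℝ) (z : X) (γ : Path z z), (∀ s t, dist (γ s) (γ t) ≤ l * dist s t) ∧ φ ⟦γ⟧ₕ ≠ 1 ∧
      ∀ {w : X} (p : PathClass w w) {l' : ℝ}, HasLengthLE p l' → φ p ≠ 1 → l ≤ l' := by
  obtain ⟨L, hL⟩ := hR.exists_hasLengthLE hgeo q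
  have hL_nonneg := hL.nonneg
  obtain ⟨γ₀, h_lip, rfl⟩ := hL
  obtain ⟨l, _, ⟨z, γ, hγ, rfl⟩, hl, h_min⟩ := exists_min_dist_le_mul
    (hR.isClosed_setOf_map_ne_one hgeo φ) hL_nonneg (g := γ₀.toContinuousMap) ⟨x, γ₀, hφ, rfl⟩
    h_lip
  refine ⟨l, z, γ, hl, hγ, fun {w} p l' h' hp => ?_⟩
  have hl' := h'.nonneg
  obtain ⟨γ', h_lip', rfl⟩ := h'
  exact h_min l' γ'.toContinuousMap hl' ⟨w, γ', hp, rfl⟩ h_lip'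

end IsSLSCRadius

end Minimizing

section ReplaceSubpath

/-- The class of the path obtained from `γ` by replacing the piece between the parameters `s` and
`t` by `g`. -/
noncomputable def PathClass.replaceSubpath {X : Type*} [TopologicalSpace X] {x y : X} (γ : Path x y)
    (s t : unitInterval) (g : PathClass (γ s) (γ t)) : PathClass x y :=
  ((⟦γ.subpath 0 s⟧ₕ.trans g).trans ⟦γ.subpath t 1⟧ₕ).cast γ.source.symm γ.target.symm

theorem PathClass.replaceSubpath_self {X : Type*} [TopologicalSpace X] {x y : X} (γ : Path x y)
    (s t : unitInterval) : PathClass.replaceSubpath γ s t ⟦γ.subpath s t⟧ₕ = ⟦γ⟧ₕ := by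
  rw [replaceSubpath, mk_subpath_trans, mk_subpath_trans, Path.subpath_zero_one,
    Path.Homotopic.Quotient.mk_cast, Path.Homotopic.Quotient.cast_cast,
    Path.Homotopic.Quotient.cast_rfl_rfl]

theorem PathHom.map_replaceSubpath_eq {X : Type*} [TopologicalSpace X] {x y : X} {G : Type*}
    [Group G] (φ : PathHom X G) (γ : Path x y) {s t : unitInterval} {g : PathClass (γ s) (γ t)}
    (h : φ g = φ ⟦γ.subpath s t⟧ₕ) : φ (PathClass.replaceSubpath γ s t g) = φ ⟦γ⟧ₕ := by
  rw [← PathClass.replaceSubpath_self γ s t]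
  simp only [PathClass.replaceSubpath, map_cast, map_trans, h]

theorem dist_unitInterval_of_le {s t : unitInterval} (h : s ≤ t) : dist s t = t - s := by
  rw [dist_comm, Subtype.dist_eq, Real.dist_eq,
    abs_of_nonneg (sub_nonneg.2 (Subtype.coe_le_coe.2 h))]

variable {X : Type*} [MetricSpace X] {x y : X}

theorem HasLengthLE.replaceSubpath {γ : Path x y} {L M : ℝ}
    (hγ : ∀ s t, dist (γ s) (γ t) ≤ L * dist s t) {s t : unitInterval} (hst : s ≤ t)
    {g : PathClass (γ s) (γ t)} (hg : HasLengthLE g M) :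
    HasLengthLE (PathClass.replaceSubpath γ s t g) (L * (1 - dist s t) + M) := by
  refine ((((subpath hγ 0 s).trans hg).trans (subpath hγ t 1)).cast _ _).mono (le_of_eq ?_)
  rw [dist_unitInterval_of_le hst, dist_unitInterval_of_le s.2.1, dist_unitInterval_of_le t.2.2,
    Set.Icc.coe_zero, Set.Icc.coe_one]
  ring

theorem IsSLSCRadius.exists_isLocalGeodesic [CompactSpace X] {R : ℝ} (hR : IsSLSCRadius X R)
    (hgeo : IsGeodesicSpace X) (q : PathClass x y) :
    ∃ γ : Path x y, ⟦γ⟧ₕ = q ∧ IsLocalGeodesic γ := by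
  obtain ⟨l, γ, h_lip, rfl, h_min⟩ := hR.exists_shortest_path hgeo q
  have hl : 0 ≤ l := HasLengthLE.nonneg ⟨γ, h_lip, rfl⟩
  refine ⟨γ, rfl, l, hl, R / (l + 1), div_pos hR.pos (by linarith), fun s t hd => ?_⟩
  wlog hst : s ≤ t generalizing s t
  · rw [dist_comm, dist_comm s t]
    exact this t s (by rwa [dist_comm]) (le_of_not_ge hst)
  have h_small : l * dist s t < R := by
    rw [lt_div_iff₀ (by linarith)] at hd
    linarith [dist_nonneg (x := s) (y := t)]
  have h_class : ⟦γ.subpath s t⟧ₕ = hgeo.geodesicClass (γ s) (γ t) := by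
    refine hR.mk_eq_geodesicClass hgeo _ fun r => ?_
    obtain ⟨u, hu, hur⟩ := Path.range_subpath_of_le γ s t hst ▸ Set.mem_range_self r
    rw [← hur]
    refine ((h_lip s u).trans (mul_le_mul_of_nonneg_left ?_ hl)).trans_lt h_small
    rw [dist_unitInterval_of_le hst, dist_unitInterval_of_le hu.1]
    exact sub_le_sub_right (Subtype.coe_le_coe.2 hu.2) _
  have h_le := HasLengthLE.replaceSubpath h_lip hst
    (hgeo.hasLengthLE_geodesicClass (γ s) (γ t))
  rw [← h_class, PathClass.replaceSubpath_self] at h_le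
  exact le_antisymm (h_lip s t) (by linarith [h_min _ h_le])

end ReplaceSubpath

/-! ### Closed curves and geodesic circles -/

theorem exists_unitInterval_coe_eq (z : UnitAddCircle) :
    ∃ t : unitInterval, ((t : ℝ) : UnitAddCircle) = z := by
  obtain ⟨t, ht, rfl⟩ : z ∈ ((↑) : ℝ → UnitAddCircle) '' Set.Ico 0 (0 + 1) := by
    rw [AddCircle.coe_image_Ico_eq]
    trivial
  exact ⟨⟨t, ht.1, by linarith [ht.2]⟩, rfl⟩

theorem dist_unitAddCircle_coe (s t : unitInterval) :
    dist ((s : ℝ) : UnitAddCircle) ((t : ℝ) : UnitAddCircle) =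
      min (dist s t) (1 - dist s t) := by
  wlog hst : s ≤ t generalizing s t
  · rw [dist_comm, dist_comm s t]
    exact this t s (le_of_not_ge hst)
  rw [dist_comm, dist_eq_norm, ← AddCircle.coe_sub, UnitAddCircle.norm_eq, abs_sub_round_eq_min,
    dist_unitInterval_of_le hst]
  have h_le : (t : ℝ) - s ≤ 1 := by linarith [s.2.1, t.2.2]
  rcases h_le.lt_or_eq with h | h
  · rw [Int.fract_eq_self.2 ⟨sub_nonneg.2 (Subtype.coe_le_coe.2 hst), h⟩]
  · simp [h]

section CircleOfLoop

variable {Y : Type*} [TopologicalSpace Y] {x : Y}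

/-- The closed curve on the circle defined by a loop. It is an inverse of `circleLoop`. -/
noncomputable def circleOfLoop (γ : Path x x) : C(UnitAddCircle, Y) where
  toFun := AddCircle.liftIco 1 0 γ.extend
  continuous_toFun := AddCircle.liftIco_zero_continuous (by simp) γ.continuous_extend.continuousOn

theorem circleOfLoop_coe (γ : Path x x) (t : unitInterval) :
    circleOfLoop γ ((t : ℝ) : UnitAddCircle) = γ t := by
  rcases t.2.2.eq_or_lt with h | h
  · have h_one : ((t : ℝ) : UnitAddCircle) = ((0 : ℝ) : UnitAddCircle) := by
      rw [h, AddCircle.coe_period, QuotientAddGroup.mk_zero]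
    rw [h_one, show t = 1 from Subtype.ext h, γ.target]
    exact (AddCircle.liftIco_zero_coe_apply (p := (1 : ℝ)) (f := γ.extend)
      ⟨le_rfl, one_pos⟩).trans γ.extend_zero
  · exact (AddCircle.liftIco_zero_coe_apply (p := (1 : ℝ)) (f := γ.extend) ⟨t.2.1, h⟩).trans
      (γ.extend_apply t.2)

theorem circleOfLoop_zero (γ : Path x x) : circleOfLoop γ 0 = x := by
  simpa using circleOfLoop_coe γ 0

theorem circleLoop_circleOfLoop (γ : Path x x) :
    circleLoop (circleOfLoop γ) = γ.cast (circleOfLoop_zero γ) (circleOfLoop_zero γ) := by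
  ext t
  exact circleOfLoop_coe γ t

end CircleOfLoop

section GeodesicCircle

variable {X : Type*} [MetricSpace X]

theorem IsGeodesicCircle.hasLengthLE {l : ℝ} {c : C(UnitAddCircle, X)} (h : IsGeodesicCircle l c) :
    HasLengthLE ⟦circleLoop c⟧ₕ l := by
  refine ⟨circleLoop c, fun s t => (h.2 _ _).trans_le (mul_le_mul_of_nonneg_left ?_ h.1.le), rfl⟩
  rw [dist_unitAddCircle_coe]
  exact min_le_left _ _

theorem isGeodesicCircle_circleOfLoop {l : ℝ} (hl : 0 < l) {x : X} {γ : Path x x}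
    (hγ : ∀ s t, dist (γ s) (γ t) = l * min (dist s t) (1 - dist s t)) :
    IsGeodesicCircle l (circleOfLoop γ) := by
  refine ⟨hl, fun z w => ?_⟩
  obtain ⟨s, rfl⟩ := exists_unitInterval_coe_eq z
  obtain ⟨t, rfl⟩ := exists_unitInterval_coe_eq w
  rw [circleOfLoop_coe, circleOfLoop_coe, hγ, dist_unitAddCircle_coe]

theorem dist_loop_le_mul_min {x : X} {γ : Path x x} {l : ℝ} (hl : 0 ≤ l)
    (hγ : ∀ s t, dist (γ s) (γ t) ≤ l * dist s t) {s t : unitInterval} (hst : s ≤ t) :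
    dist (γ s) (γ t) ≤ l * min (dist s t) (1 - dist s t) := by
  rw [mul_min_of_nonneg _ _ hl]
  refine le_min (hγ s t) ?_
  have hs := hγ 0 s
  have ht := hγ t 1
  rw [γ.source, dist_unitInterval_of_le s.2.1, Set.Icc.coe_zero] at hs
  rw [γ.target, dist_unitInterval_of_le t.2.2, Set.Icc.coe_one] at ht
  rw [dist_unitInterval_of_le hst]
  calc dist (γ s) (γ t) ≤ dist x (γ s) + dist (γ t) x := by
        simpa only [dist_comm] using dist_triangle (γ s) x (γ t)
    _ ≤ l * (1 - (t - s)) := by linarith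

theorem IsGeodesicSpace.dist_shortest_loop (hgeo : IsGeodesicSpace X) {G : Type*} [Group G]
    (φ : PathHom X G) {x : X} {γ : Path x x} {l : ℝ} (hl : 0 ≤ l)
    (h_lip : ∀ s t, dist (γ s) (γ t) ≤ l * dist s t) (hφ : φ ⟦γ⟧ₕ ≠ 1)
    (h_min : ∀ {w : X} (p : PathClass w w) {l' : ℝ}, HasLengthLE p l' → φ p ≠ 1 → l ≤ l')
    (s t : unitInterval) : dist (γ s) (γ t) = l * min (dist s t) (1 - dist s t) := by
  wlog hst : s ≤ t generalizing s t
  · rw [dist_comm, dist_comm s t]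
    exact this t s (le_of_not_ge hst)
  refine (dist_loop_le_mul_min hl h_lip hst).antisymm (le_of_not_gt fun h_lt => ?_)
  rw [mul_min_of_nonneg _ _ hl, lt_min_iff] at h_lt
  let g := hgeo.geodesicClass (γ s) (γ t)
  have hg : HasLengthLE g (dist (γ s) (γ t)) := hgeo.hasLengthLE_geodesicClass _ _
  have h_digon : φ g = φ ⟦γ.subpath s t⟧ₕ := by
    by_contra h_ne
    have h_le := h_min (⟦γ.subpath s t⟧ₕ.trans g.symm)
      ((HasLengthLE.subpath h_lip s t).trans hg.symm)
      (by rwa [φ.map_trans, φ.map_symm, ne_eq, inv_mul_eq_one])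
    linarith [h_lt.2]
  have h_le := h_min _ (HasLengthLE.replaceSubpath h_lip hst hg)
    (by rwa [φ.map_replaceSubpath_eq γ h_digon])
  linarith [h_lt.1]

theorem IsSLSCRadius.exists_shortest_isGeodesicCircle [CompactSpace X] {R : ℝ}
    (hR : IsSLSCRadius X R) (hgeo : IsGeodesicSpace X) {G : Type*} [Group G] (φ : PathHom X G)
    {x : X} {q : PathClass x x} (hφ : φ q ≠ 1) :
    ∃ (l : ℝ) (c : C(UnitAddCircle, X)), IsGeodesicCircle l c ∧ φ ⟦circleLoop c⟧ₕ ≠ 1 ∧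
      ∀ {w : X} (p : PathClass w w) {l' : ℝ}, HasLengthLE p l' → φ p ≠ 1 → l ≤ l' := by
  obtain ⟨l, z, γ, h_lip, hγ, h_min⟩ := hR.exists_shortest_loop hgeo φ hφ
  have hl : 0 ≤ l := HasLengthLE.nonneg ⟨γ, h_lip, rfl⟩
  have h_pos : 0 < l := by
    refine hl.lt_of_ne fun h_zero => hγ ?_
    have h_const : γ = Path.refl z := by
      ext t
      simpa [← h_zero] using h_lip t 0
    rw [h_const, Path.Homotopic.Quotient.mk_refl, φ.map_refl]
  refine ⟨l, circleOfLoop γ, isGeodesicCircle_circleOfLoop h_pos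
    (hgeo.dist_shortest_loop φ hl h_lip hγ h_min), ?_, h_min⟩
  rwa [circleLoop_circleOfLoop, Path.Homotopic.Quotient.mk_cast, φ.map_cast]

end GeodesicCircle

section FreeHomotopy

variable {Y : Type*} [TopologicalSpace Y]

theorem circleOfLoop_circleLoop (c : C(UnitAddCircle, Y)) : circleOfLoop (circleLoop c) = c := by
  ext z
  obtain ⟨t, rfl⟩ := exists_unitInterval_coe_eq z
  exact circleOfLoop_coe _ t

theorem circleOfLoop_homotopic_of_family {δ : unitInterval → Y} (Γ : ∀ s, Path (δ s) (δ s))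
    (hΓ : Continuous fun p : unitInterval × unitInterval => Γ p.1 p.2) :
    (circleOfLoop (Γ 0)).Homotopic (circleOfLoop (Γ 1)) := by
  let G : C(unitInterval, C(unitInterval, Y)) :=
    ContinuousMap.curry (ContinuousMap.comp ⟨_, hΓ⟩ ContinuousMap.prodSwap)
  let loop : Path (G 0) (G 0) :=
    ⟨G, rfl, ContinuousMap.ext fun s => (Γ s).target.trans (Γ s).source.symm⟩
  refine ⟨⟨⟨fun p => circleOfLoop loop p.2 p.1, ?_⟩, fun z => ?_, fun z => ?_⟩⟩
  · have h_pair : Continuous fun p : unitInterval × UnitAddCircle =>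
        (circleOfLoop loop p.2, p.1) := by fun_prop
    exact continuous_eval.comp h_pair
  all_goals
    obtain ⟨t, rfl⟩ := exists_unitInterval_coe_eq z
    exact (DFunLike.congr_fun (circleOfLoop_coe loop t) _).trans (circleOfLoop_coe _ t).symm

theorem circleOfLoop_homotopic {x : Y} {γ γ' : Path x x} (h : ⟦γ⟧ₕ = ⟦γ'⟧ₕ) :
    (circleOfLoop γ).Homotopic (circleOfLoop γ') := by
  obtain ⟨F⟩ := Path.Homotopic.Quotient.eq.1 h
  simpa only [F.eval_zero, F.eval_one] using circleOfLoop_homotopic_of_family F.eval F.continuous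

theorem circleOfLoop_conj_homotopic {x y : Y} (δ : Path x y) (γ : Path y y) :
    (circleOfLoop ((δ.trans γ).trans δ.symm)).Homotopic (circleOfLoop γ) := by
  let tail : ∀ s, Path (δ s) y := fun s => (δ.subpath s 1).cast rfl δ.target.symm
  have h_tail : Continuous fun p : unitInterval × unitInterval => tail p.1 p.2 :=
    δ.subpath_continuous_family.comp (by fun_prop : Continuous
      fun p : unitInterval × unitInterval => (p.1, (1 : unitInterval), p.2))
  have h_family := circleOfLoop_homotopic_of_family
    (fun s => ((tail s).trans γ).trans (tail s).symm)
    (Path.trans_continuous_family (fun s => (tail s).trans γ)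
      (Path.trans_continuous_family tail h_tail (fun _ => γ) (γ.continuous.comp continuous_snd))
      (fun s => (tail s).symm) (Path.symm_continuous_family tail h_tail))
  have h_zero : tail 0 = δ.cast δ.source rfl := by
    ext u
    simp [tail]
  have h_one : tail 1 = (Path.refl y).cast δ.target rfl := by
    ext u
    simp [tail]
  have h_cast : ∀ {w z : Y} (h : w = z) (ε : Path z y), circleOfLoop
      (((ε.cast h rfl).trans γ).trans (ε.cast h rfl).symm) =
        circleOfLoop ((ε.trans γ).trans ε.symm) := by
    rintro _ _ rfl _; rfl
  simp only [h_zero, h_one, h_cast] at h_family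
  refine h_family.trans (circleOfLoop_homotopic ?_)
  simp only [Path.Homotopic.Quotient.mk_trans, Path.refl_symm, Path.Homotopic.Quotient.mk_refl,
    Path.Homotopic.Quotient.trans_refl, Path.Homotopic.Quotient.refl_trans]

theorem homotopic_of_circleLoop_trans_eq {c c' : C(UnitAddCircle, Y)} (δ : Path (c 0) (c' 0))
    (h : ⟦circleLoop c⟧ₕ.trans ⟦δ⟧ₕ = ⟦δ⟧ₕ.trans ⟦circleLoop c'⟧ₕ) : c.Homotopic c' := by
  have h_conj : ⟦circleLoop c⟧ₕ = ⟦(δ.trans (circleLoop c')).trans δ.symm⟧ₕ := by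
    rw [Path.Homotopic.Quotient.mk_trans, Path.Homotopic.Quotient.mk_trans, ← h,
      Path.Homotopic.Quotient.mk_symm, Path.Homotopic.Quotient.trans_assoc,
      Path.Homotopic.Quotient.trans_symm, Path.Homotopic.Quotient.trans_refl]
  simpa only [circleOfLoop_circleLoop] using
    (circleOfLoop_homotopic h_conj).trans (circleOfLoop_conj_homotopic δ (circleLoop c'))

theorem PathHom.map_circleLoop_eq_one_iff {G : Type*} [Group G] (φ : PathHom Y G)
    {c c' : C(UnitAddCircle, Y)} (h : c.Homotopic c') :
    φ ⟦circleLoop c⟧ₕ = 1 ↔ φ ⟦circleLoop c'⟧ₕ = 1 := by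
  obtain ⟨F⟩ := h
  exact φ.map_eq_one_iff_of_trans_eq (a := ⟦F.evalAt 0⟧ₕ) (Path.Homotopic.Quotient.eq.2
    (Path.Homotopic.map_trans_evalAt F (circleLoop (ContinuousMap.id UnitAddCircle))))

end FreeHomotopy

/-! ### Finiteness and generation -/

theorem finite_of_separated {Y Q : Type*} [PseudoMetricSpace Y] {K : Set Y} (hK : IsCompact K)
    {A : Set Q} {Represents : Y → Q → Prop} {ε : ℝ} (hε : 0 < ε)
    (h_exists : ∀ q ∈ A, ∃ f ∈ K, Represents f q)
    (h_sep : ∀ {f f' q q'}, Represents f q → Represents f' q' → dist f f' < ε → q = q') :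
    A.Finite := by
  choose f hfK hf using fun q : A => h_exists q q.2
  obtain ⟨t, -, ht, h_cover⟩ := hK.finite_cover_balls (half_pos hε)
  have h_center : ∀ q, ∃ y : t, dist (f q) y < ε / 2 := fun q => by
    simpa using h_cover (hfK q)
  choose center h_dist using h_center
  have := ht.to_subtype
  have h_inj : Function.Injective center := fun q q' h_eq => by
    refine Subtype.ext (h_sep (hf q) (hf q') ((dist_triangle_right _ _ (center q : Y)).trans_lt ?_))
    exact (add_lt_add (h_dist q) (h_eq ▸ h_dist q')).trans_eq (add_halves ε)
  exact Set.finite_coe_iff.1 (Finite.of_injective center h_inj)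

theorem exists_finite_subset_mem_closure {G : Type*} [Group G] {S : Set G} {g : G}
    (hg : g ∈ Subgroup.closure S) : ∃ T ⊆ S, T.Finite ∧ g ∈ Subgroup.closure T := by
  induction hg using Subgroup.closure_induction with
  | mem x hx =>
    exact ⟨{x}, by simpa using hx, Set.finite_singleton x, Subgroup.subset_closure rfl⟩
  | one => exact ⟨∅, Set.empty_subset _, Set.finite_empty, one_mem _⟩
  | mul x y _ _ hx hy =>
    obtain ⟨T, hT, hT_fin, hxT⟩ := hx
    obtain ⟨T', hT', hT'_fin, hyT'⟩ := hy
    exact ⟨T ∪ T', Set.union_subset hT hT', hT_fin.union hT'_fin, mul_mem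
      (Subgroup.closure_mono Set.subset_union_left hxT)
      (Subgroup.closure_mono Set.subset_union_right hyT')⟩
  | inv x _ hx =>
    obtain ⟨T, hT, hT_fin, hxT⟩ := hx
    exact ⟨T, hT, hT_fin, inv_mem hxT⟩

theorem exists_finite_subset_closure_eq_top {G : Type*} [Group G] [Group.FG G] {S : Set G}
    (hS : Subgroup.closure S = ⊤) : ∃ T ⊆ S, T.Finite ∧ Subgroup.closure T = ⊤ := by
  obtain ⟨B, hB, hB_fin⟩ := Group.fg_iff.1 ‹Group.FG G›
  have h_subset : ∀ g : G, ∃ T ⊆ S, T.Finite ∧ g ∈ Subgroup.closure T := fun g =>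
    exists_finite_subset_mem_closure (hS ▸ Subgroup.mem_top g)
  choose T hTS hT_fin hT using h_subset
  refine ⟨⋃ b ∈ B, T b, Set.iUnion₂_subset fun b _ => hTS b,
    hB_fin.biUnion fun b _ => hT_fin b, ?_⟩
  rw [eq_top_iff, ← hB, Subgroup.closure_le]
  exact fun b hb => Subgroup.closure_mono (Set.subset_biUnion_of_mem hb) (hT b)

section Finiteness

variable {X : Type*} [MetricSpace X]

theorem IsGeodesicCircle.length_le [BoundedSpace X] {l : ℝ} {c : C(UnitAddCircle, X)}
    (h : IsGeodesicCircle l c) : l ≤ 2 * Metric.diam (Set.univ : Set X) := by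
  let half : unitInterval := ⟨1 / 2, by norm_num, by norm_num⟩
  have h_antipodal := h.2 (((0 : unitInterval) : ℝ) : UnitAddCircle) ((half : ℝ) : UnitAddCircle)
  have h_half : dist (0 : unitInterval) half = 1 / 2 := by
    rw [dist_unitInterval_of_le half.2.1]
    simp [half]
  rw [dist_unitAddCircle_coe, h_half] at h_antipodal
  norm_num at h_antipodal
  have := Metric.dist_le_diam_of_mem (Bornology.IsBounded.all Set.univ)
    (Set.mem_univ (c 0)) (Set.mem_univ (c ((half : ℝ) : UnitAddCircle)))
  linarith

variable {R : ℝ}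

namespace IsSLSCRadius

variable (hR : IsSLSCRadius X R) (hgeo : IsGeodesicSpace X)
include hR hgeo

theorem homotopic_of_dist_lt {c c' : C(UnitAddCircle, X)} (h : dist c c' < R / 2) :
    c.Homotopic c' :=
  homotopic_of_circleLoop_trans_eq (hgeo.geodesic (c 0) (c' 0))
    (hR.trans_geodesicClass hgeo (circleLoop c) (circleLoop c') fun _ =>
      (ContinuousMap.dist_apply_le_dist (f := c) (g := c') _).trans_lt h)

theorem finite_freeHomotopyClass [CompactSpace X] :
    {C | ∃ (l : ℝ) (c : C(UnitAddCircle, X)),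
      IsGeodesicCircle l c ∧ freeHomotopyClass c = C}.Finite := by
  refine finite_of_separated (isCompact_setOf_dist_le_mul UnitAddCircle
    (2 * Metric.diam (Set.univ : Set X))) (half_pos hR.pos)
    (Represents := fun c C => freeHomotopyClass c = C) ?_ ?_
  · rintro _ ⟨l, c, hc, rfl⟩
    refine ⟨c, fun s t => ?_, rfl⟩
    rw [hc.2]
    exact mul_le_mul_of_nonneg_right hc.length_le dist_nonneg
  · rintro c c' _ _ rfl rfl h
    exact Quotient.sound (hR.homotopic_of_dist_lt hgeo h)

theorem finite_setOf_hasLengthLE [CompactSpace X] (x y : X) (L : ℝ) :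
    {q : PathClass x y | HasLengthLE q L}.Finite := by
  refine finite_of_separated (isCompact_setOf_dist_le_mul unitInterval L) (half_pos hR.pos)
    (Represents := fun f q => ∃ γ : Path x y, γ.toContinuousMap = f ∧ ⟦γ⟧ₕ = q) ?_ ?_
  · rintro _ ⟨γ, hγ, rfl⟩
    exact ⟨γ.toContinuousMap, hγ, γ, rfl, rfl⟩
  · rintro _ _ _ _ ⟨γ, rfl, rfl⟩ ⟨γ', rfl, rfl⟩ h
    exact hR.mk_eq_of_close hgeo γ γ' fun t => (ContinuousMap.dist_apply_le_dist t).trans_lt h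

theorem closure_setOf_hasLengthLE [BoundedSpace X] (x₀ : X) :
    Subgroup.closure {g : FundamentalGroup X x₀ |
      HasLengthLE (FundamentalGroup.toPath g) (2 * Metric.diam (Set.univ : Set X) + R)} = ⊤ := by
  set S := {g : FundamentalGroup X x₀ |
    HasLengthLE (FundamentalGroup.toPath g) (2 * Metric.diam (Set.univ : Set X) + R)}
  have h_diam : ∀ x y : X, dist x y ≤ Metric.diam (Set.univ : Set X) := fun x y =>
    Metric.dist_le_diam_of_mem (Bornology.IsBounded.all _) trivial trivial
  let φ := PathHom.ofBasePaths (hgeo.geodesicClass x₀)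
  have h_mem : ∀ {x y : X} (q : PathClass x y), φ q ∈ Subgroup.closure S := fun q => by
    induction q using hR.geodesic_induction hgeo with
    | trans p q hp hq => exact φ.map_trans p q ▸ mul_mem hq hp
    | geodesicClass x y h =>
      refine Subgroup.subset_closure (HasLengthLE.mono
        (((hgeo.hasLengthLE_geodesicClass x₀ x).trans (hgeo.hasLengthLE_geodesicClass x y)).trans
          (hgeo.hasLengthLE_geodesicClass x₀ y).symm) ?_)
      linarith [h_diam x₀ x, h_diam x₀ y]
  refine eq_top_iff.2 fun g _ => ?_
  have h := h_mem (FundamentalGroup.toPath g)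
  rwa [PathHom.ofBasePaths_loop (hgeo.geodesicClass_self x₀)] at h

theorem fundamentalGroup_fg [CompactSpace X] (x₀ : X) : Group.FG (FundamentalGroup X x₀) :=
  Group.fg_iff.2 ⟨_, hR.closure_setOf_hasLengthLE hgeo x₀,
    hR.finite_setOf_hasLengthLE hgeo x₀ x₀ _⟩

theorem conj_circleLoop_mem_geodesicLassoClasses [CompactSpace X] {x₀ : X} {l : ℝ}
    {c : C(UnitAddCircle, X)} (hc : IsGeodesicCircle l c) (q : PathClass x₀ (c 0)) :
    FundamentalGroup.fromPath ((q.trans ⟦circleLoop c⟧ₕ).trans q.symm) ∈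
      geodesicLassoClasses x₀ := by
  obtain ⟨α, rfl, hα⟩ := hR.exists_isLocalGeodesic hgeo q
  exact ⟨l, c, α, hc, hα, rfl⟩

theorem conj_mem_geodesicLassoClasses [CompactSpace X] {x₀ : X} {a : FundamentalGroup X x₀}
    (ha : a ∈ geodesicLassoClasses x₀) (g : FundamentalGroup X x₀) :
    g * a * g⁻¹ ∈ geodesicLassoClasses x₀ := by
  obtain ⟨l, c, α, hc, -, rfl⟩ := ha
  convert hR.conj_circleLoop_mem_geodesicLassoClasses hgeo hc
    ((FundamentalGroup.toPath g).symm.trans ⟦α⟧ₕ) using 1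
  rw [FundamentalGroup.mul_def, FundamentalGroup.mul_def, FundamentalGroup.inv_def,
    PathClass.symm_trans_rev, PathClass.symm_symm]
  simp only [Path.Homotopic.Quotient.mk_trans, Path.Homotopic.Quotient.mk_symm,
    Path.Homotopic.Quotient.trans_assoc]

theorem normalClosure_geodesicLassoClasses [CompactSpace X] (x₀ : X) :
    Subgroup.normalClosure (geodesicLassoClasses x₀) =
      Subgroup.closure (geodesicLassoClasses x₀) := by
  refine le_antisymm (Subgroup.closure_mono fun a ha => ?_) Subgroup.closure_le_normalClosure
  obtain ⟨b, hb, hab⟩ := Group.mem_conjugatesOfSet_iff.1 ha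
  obtain ⟨g, rfl⟩ := isConj_iff.1 hab
  exact hR.conj_mem_geodesicLassoClasses hgeo hb g

theorem closure_geodesicLassoClasses [CompactSpace X] (x₀ : X) :
    Subgroup.closure (geodesicLassoClasses x₀) = ⊤ := by
  rw [← hR.normalClosure_geodesicLassoClasses hgeo, eq_top_iff]
  intro g _
  let τ := PathHom.ofBasePaths (hgeo.geodesicClass x₀)
  let φ := τ.postcomp (QuotientGroup.mk' (Subgroup.normalClosure (geodesicLassoClasses x₀)))
  have hφ : ∀ {x : X} (p : PathClass x x), φ p = 1 ↔
      τ p ∈ Subgroup.normalClosure (geodesicLassoClasses x₀) := fun p =>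
    QuotientGroup.eq_one_iff (τ p)
  have h_circle : ∀ {l : ℝ} {c : C(UnitAddCircle, X)}, IsGeodesicCircle l c →
      φ ⟦circleLoop c⟧ₕ = 1 := fun hc => (hφ _).2 <| Subgroup.subset_normalClosure <|
    hR.conj_circleLoop_mem_geodesicLassoClasses hgeo hc (hgeo.geodesicClass x₀ _)
  suffices h : φ (FundamentalGroup.toPath g) = 1 by
    rwa [hφ, PathHom.ofBasePaths_loop (hgeo.geodesicClass_self x₀)] at h
  by_contra h_ne
  obtain ⟨l, c, hc, hc_ne, -⟩ := hR.exists_shortest_isGeodesicCircle hgeo φ h_ne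
  exact hc_ne (h_circle hc)

theorem exists_finite_generating_geodesicLassoClasses [CompactSpace X] (x₀ : X) :
    ∃ T ⊆ geodesicLassoClasses x₀, T.Finite ∧ Subgroup.closure T = ⊤ := by
  have := hR.fundamentalGroup_fg hgeo x₀
  exact exists_finite_subset_closure_eq_top (hR.closure_geodesicLassoClasses hgeo x₀)

end IsSLSCRadius

end Finiteness

/-! ### The Rips complex of a geodesic space -/

section Rips

open GeomRealization

variable {X : Type*} [MetricSpace X] {r : ℝ} (hr : 0 < r) {x y z : X}

theorem mem_ripsComplex_faces {σ : Finset X} (hσ : σ.Nonempty)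
    (h : ∀ a ∈ σ, ∀ b ∈ σ, dist a b < r) : σ ∈ (ripsComplex X r hr).faces := by
  obtain ⟨⟨a, b⟩, hab, hmax⟩ := Finset.exists_max_image (σ ×ˢ σ) (fun p => dist p.1 p.2)
    (hσ.product hσ)
  rw [Finset.mem_product] at hab
  refine ⟨hσ, lt_of_le_of_lt ?_ (h a hab.1 b hab.2)⟩
  exact Metric.diam_le_of_forall_dist_le dist_nonneg fun x hx y hy =>
    hmax (x, y) (Finset.mem_product.2 ⟨hx, hy⟩)

variable {hr} in
theorem dist_lt_of_mem_ripsComplex_face (σ : (ripsComplex X r hr).faces) (hx : x ∈ σ.1)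
    (hy : y ∈ σ.1) : dist x y < r :=
  (Metric.dist_le_diam_of_mem σ.1.finite_toSet.isBounded hx hy).trans_lt σ.2.2

theorem exists_ripsComplex_face (hxy : dist x y < r) (hyz : dist y z < r) (hxz : dist x z < r) :
    ∃ σ : (ripsComplex X r hr).faces, x ∈ σ.1 ∧ y ∈ σ.1 ∧ z ∈ σ.1 := by
  classical
  refine ⟨⟨{x, y, z}, mem_ripsComplex_faces hr (Finset.insert_nonempty _ _) ?_⟩,
    by simp, by simp, by simp⟩
  simp only [Finset.forall_mem_insert, Finset.mem_singleton, forall_eq, dist_self, dist_comm y x,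
    dist_comm z]
  exact ⟨⟨hr, hxy, hxz⟩, ⟨hxy, hr, hyz⟩, hxz, hyz, hr⟩

theorem ripsComplex_adjacent_iff : Adjacent (ripsComplex X r hr) x y ↔ dist x y < r := by
  refine ⟨fun ⟨σ, hx, hy⟩ => dist_lt_of_mem_ripsComplex_face σ hx hy, fun h => ?_⟩
  obtain ⟨σ, hx, hy, -⟩ := exists_ripsComplex_face hr h (by rwa [dist_self]) h
  exact ⟨σ, hx, hy⟩

/-- The class of the edge joining two points at distance less than `r`. -/
noncomputable def ripsEdge (h : dist x y < r) :
    PathClass (vertex (ripsComplex X r hr) x) (vertex (ripsComplex X r hr) y) :=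
  edge ((ripsComplex_adjacent_iff hr).2 h)

theorem ripsEdge_trans (hxy : dist x y < r) (hyz : dist y z < r) (hxz : dist x z < r) :
    (ripsEdge hr hxy).trans (ripsEdge hr hyz) = ripsEdge hr hxz := by
  obtain ⟨σ, hx, hy, hz⟩ := exists_ripsComplex_face hr hxy hyz hxz
  exact edge_trans σ hx hy hz _ _ _

theorem ripsEdge_self (h : dist x x < r) : ripsEdge hr h = Path.Homotopic.Quotient.refl _ :=
  edge_self _

theorem ripsEdge_map_inclusion {s : ℝ} (hs : 0 < s) (hrs : r ≤ s) (h : dist x y < r)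
    (h' : dist x y < s) :
    (ripsEdge hr h).map (inclusion (ripsComplex_faces_mono X hr hs hrs)) = ripsEdge hs h' :=
  edge_map_inclusion _ _ _

theorem ripsComplex_joined (hgeo : IsGeodesicSpace X) (x : X)
    (p : GeomRealization (ripsComplex X r hr)) : Joined (vertex (ripsComplex X r hr) x) p := by
  have h_vertex : ∀ y, Joined (vertex (ripsComplex X r hr) x) (vertex _ y) := by
    intro y
    let γ := hgeo.geodesic x y
    have h_iff := iff_of_eventually_iff (X := unitInterval) (P := fun t =>
      Joined (vertex (ripsComplex X r hr) x) (vertex _ (γ t))) (fun t => ?_) 0 1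
    · rw [γ.source, γ.target] at h_iff
      exact h_iff.1 (Joined.refl _)
    · filter_upwards [γ.continuous.continuousAt.preimage_mem_nhds
        (Metric.ball_mem_nhds (γ t) hr)] with s hs
      have h_edge := ((ripsComplex_adjacent_iff hr).2 hs).joined
      exact ⟨fun h => h.trans h_edge, fun h => h.trans h_edge.symm⟩
  obtain ⟨v, hv⟩ := exists_mem_openStar p
  exact (h_vertex v).trans (joined_vertex hv).symm

/-- The group `π₁(Rips(X, r), x₀)`. -/
abbrev RipsGroup (x₀ : X) : Type _ :=
  FundamentalGroup (GeomRealization (ripsComplex X r hr)) (vertex (ripsComplex X r hr) x₀)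

variable (hgeo : IsGeodesicSpace X) (x₀ : X)

/-- A retraction of the fundamental groupoid of the Rips complex to the fundamental group at
`x₀`. -/
noncomputable def ripsRetraction :
    PathHom (GeomRealization (ripsComplex X r hr)) (RipsGroup hr x₀) :=
  .ofBasePaths fun p => ⟦(ripsComplex_joined hr hgeo x₀ p).somePath⟧ₕ

/-- The edges of the Rips complex, as a cocycle on the cover of `X` by balls of radius `r / 2`. -/
noncomputable def ripsCocycle : LocallyConstantCocycle X X (RipsGroup hr x₀) where
  cover x := Metric.ball x (r / 2)
  isOpen_cover _ := Metric.isOpen_ball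
  index := id
  mem_cover_index _ := Metric.mem_ball_self (half_pos hr)
  trans x y :=
    open Classical in
    if h : dist x y < r then ripsRetraction hr hgeo x₀ (ripsEdge hr h) else 1
  trans_mul_trans := by
    rintro x y z ⟨w, ⟨hx, hy⟩, hz⟩
    have h_lt : ∀ {a b}, w ∈ Metric.ball a (r / 2) → w ∈ Metric.ball b (r / 2) → dist a b < r := by
      intro a b ha hb
      rw [Metric.mem_ball] at ha hb
      linarith [dist_triangle_left a b w]
    rw [dif_pos (h_lt hx hy), dif_pos (h_lt hy hz), dif_pos (h_lt hx hz), ← PathHom.map_trans,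
      ripsEdge_trans]

/-- The homomorphism sending a path of `X` to the edge path through finely spaced points on it. -/
noncomputable def ripsHolonomy : PathHom X (RipsGroup hr x₀) :=
  (ripsCocycle hr hgeo x₀).holonomy

theorem ripsCocycle_trans (h : dist x y < r) :
    (ripsCocycle hr hgeo x₀).trans x y = ripsRetraction hr hgeo x₀ (ripsEdge hr h) :=
  dif_pos h

theorem ripsHolonomy_of_hasLengthLE {q : PathClass x y} {L : ℝ} (hq : HasLengthLE q L)
    (hL : L < r) : ripsHolonomy hr hgeo x₀ q =
      ripsRetraction hr hgeo x₀ (ripsEdge hr (hq.dist_le.trans_lt hL)) := by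
  have hxy := hq.dist_le.trans_lt hL
  have hL₀ := hq.nonneg
  obtain ⟨γ, hγ, rfl⟩ := hq
  let m : unitInterval := ⟨1 / 2, by norm_num, by norm_num⟩
  have h_near : ∀ t, dist (γ t) (γ m) < r / 2 := fun t => by
    have : dist t m ≤ 1 / 2 := by
      rw [Subtype.dist_eq, Real.dist_eq, abs_le]
      constructor <;> linarith [t.2.1, t.2.2, show (m : ℝ) = 1 / 2 from rfl]
    nlinarith [hγ t m]
  have hx : dist x (γ m) < r := by
    have := h_near 0
    rw [γ.source] at this
    linarith
  have hy : dist (γ m) y < r := by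
    have := h_near 1
    rw [γ.target, dist_comm] at this
    linarith
  rw [ripsHolonomy, (ripsCocycle hr hgeo x₀).holonomy_mk (k := γ m) γ h_near,
    ← ripsEdge_trans hr hx hy hxy,
    PathHom.map_trans, ← ripsCocycle_trans, ← ripsCocycle_trans]
  rfl

theorem ripsHolonomy_eq_one {q : PathClass x x} {L : ℝ} (hq : HasLengthLE q L)
    (hL : L < 3 * r) : ripsHolonomy hr hgeo x₀ q = 1 := by
  obtain ⟨γ, hγ, rfl⟩ := hq
  let a : unitInterval := ⟨1 / 3, by norm_num, by norm_num⟩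
  let b : unitInterval := ⟨2 / 3, by norm_num, by norm_num⟩
  have h_third : ∀ s t : unitInterval, (t : ℝ) - s = 1 / 3 → L * dist s t < r := by
    intro s t hst
    rw [dist_unitInterval_of_le (Subtype.coe_le_coe.1 (by linarith)), hst]
    linarith
  have h₀a := h_third 0 a (by norm_num [a])
  have hab := h_third a b (by norm_num [a, b])
  have hb₁ := h_third b 1 (by norm_num [b])
  have h_closed : γ 1 = γ 0 := γ.target.trans γ.source.symm
  have h_thirds : ripsHolonomy hr hgeo x₀ ⟦γ⟧ₕ = ripsHolonomy hr hgeo x₀ ⟦γ.subpath b 1⟧ₕ *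
      (ripsHolonomy hr hgeo x₀ ⟦γ.subpath a b⟧ₕ * ripsHolonomy hr hgeo x₀ ⟦γ.subpath 0 a⟧ₕ) := by
    rw [← PathHom.map_trans, ← PathHom.map_trans, PathClass.mk_subpath_trans,
      PathClass.mk_subpath_trans, Path.subpath_zero_one, Path.Homotopic.Quotient.mk_cast,
      PathHom.map_cast]
  have d₀a := (hγ 0 a).trans_lt h₀a
  have dab := (hγ a b).trans_lt hab
  have db₁ := (hγ b 1).trans_lt hb₁
  have d₀₁ : dist (γ 0) (γ 1) < r := by rwa [h_closed, dist_self]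
  have d₀b : dist (γ 0) (γ b) < r := by rwa [← h_closed, dist_comm]
  rw [h_thirds, ripsHolonomy_of_hasLengthLE hr hgeo x₀ (.subpath hγ b 1) hb₁,
    ripsHolonomy_of_hasLengthLE hr hgeo x₀ (.subpath hγ a b) hab,
    ripsHolonomy_of_hasLengthLE hr hgeo x₀ (.subpath hγ 0 a) h₀a,
    ← PathHom.map_trans, ← PathHom.map_trans, ripsEdge_trans hr d₀a dab d₀b,
    ripsEdge_trans hr d₀b db₁ d₀₁]
  generalize γ 1 = u at h_closed d₀₁
  subst h_closed
  rw [ripsEdge_self, PathHom.map_refl]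

section BondingMap

variable {p q : ℝ} (hp : 0 < p) (hq : 0 < q) (hpq : p ≤ q)

theorem ripsPi1Map_apply (a : RipsGroup hp x₀) : ripsPi1Map x₀ p q hp hq hpq a =
    (FundamentalGroup.toPath a).map (inclusion (ripsComplex_faces_mono X hp hq hpq)) := by
  rw [ripsPi1Map, FundamentalGroup.mapOfEq_apply]
  exact Path.Homotopic.Quotient.cast_rfl_rfl _

include hgeo in
theorem exists_map_inclusion_eq_ripsEdge (h : dist x y < q) :
    ∃ c : PathClass (vertex (ripsComplex X p hp) x) (vertex (ripsComplex X p hp) y),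
      c.map (inclusion (ripsComplex_faces_mono X hp hq hpq)) = ripsEdge hq h := by
  let Lifts (z : X) : Prop := ∀ h : dist x z < q,
    ∃ c : PathClass (vertex (ripsComplex X p hp) x) (vertex (ripsComplex X p hp) z),
      c.map (inclusion (ripsComplex_faces_mono X hp hq hpq)) = ripsEdge hq h
  have h_step : ∀ {z w}, dist x z < q → dist z w < p → Lifts z → Lifts w := by
    intro z w hz hzw h_lift hw
    obtain ⟨c, hc⟩ := h_lift hz
    refine ⟨c.trans (ripsEdge hp hzw), ?_⟩
    rw [← ripsEdge_trans hq hz (hzw.trans_le hpq) hw, PathClass.map_trans, hc,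
      ← ripsEdge_map_inclusion hp hq hpq hzw]
    rfl
  let γ := hgeo.geodesic x y
  have hγ : ∀ t, dist x (γ t) < q := fun t => (hgeo.dist_left_geodesic_le x y t).trans_lt h
  have h_iff := iff_of_eventually_iff (X := unitInterval) (P := fun t => Lifts (γ t))
    (fun t => ?_) 0 1
  · rw [γ.source, γ.target] at h_iff
    refine h_iff.1 (fun h_self => ?_) h
    rw [ripsEdge_self]
    exact ⟨Path.Homotopic.Quotient.refl _, rfl⟩
  · filter_upwards [γ.continuous.continuousAt.preimage_mem_nhds
      (Metric.ball_mem_nhds (γ t) hp)] with s hs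
    exact ⟨h_step (hγ s) hs, h_step (hγ t) (by rwa [dist_comm])⟩

include hgeo in
theorem ripsPi1Map_surjective : Function.Surjective (ripsPi1Map x₀ p q hp hq hpq) := by
  have h_lift : ∀ {v w : X}
      (c : PathClass (vertex (ripsComplex X q hq) v) (vertex (ripsComplex X q hq) w)),
      ∃ c' : PathClass (vertex (ripsComplex X p hp) v) (vertex (ripsComplex X p hp) w),
        c'.map (inclusion (ripsComplex_faces_mono X hp hq hpq)) = c := by
    intro v w
    refine edge_induction (P := fun v w c => ∃ c' : PathClass (vertex (ripsComplex X p hp) v)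
      (vertex (ripsComplex X p hp) w), c'.map (inclusion _) = c) ?_ fun h =>
        exists_map_inclusion_eq_ripsEdge hgeo hp hq hpq ((ripsComplex_adjacent_iff hq).1 h)
    rintro u v w _ _ ⟨c, rfl⟩ ⟨d, rfl⟩
    exact ⟨c.trans d, PathClass.map_trans _ c d⟩
  intro a
  obtain ⟨c, hc⟩ := h_lift (FundamentalGroup.toPath a)
  exact ⟨FundamentalGroup.fromPath c, (ripsPi1Map_apply x₀ hp hq hpq _).trans hc⟩

theorem ripsPi1Map_injective
    (h : ∀ {x : X} {c : PathClass x x} {L : ℝ}, HasLengthLE c L → L < 3 * q →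
      ripsHolonomy hp hgeo x₀ c = 1) :
    Function.Injective (ripsPi1Map x₀ p q hp hq hpq) := by
  let i := inclusion (ripsComplex_faces_mono X hp hq hpq)
  let Φ := (starCocycle (K := ripsComplex X q hq)
    (fun x y => ripsHolonomy hp hgeo x₀ (hgeo.geodesicClass x y)) (by
      intro σ u v w hu hv hw
      have huv := dist_lt_of_mem_ripsComplex_face σ hu hv
      have hvw := dist_lt_of_mem_ripsComplex_face σ hv hw
      have huw := dist_lt_of_mem_ripsComplex_face σ hu hw
      have h_triangle := h (((hgeo.hasLengthLE_geodesicClass u v).trans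
        (hgeo.hasLengthLE_geodesicClass v w)).trans
          (hgeo.hasLengthLE_geodesicClass u w).symm) (by linarith)
      rwa [PathHom.map_trans, PathHom.map_symm, inv_mul_eq_one, PathHom.map_trans,
        eq_comm] at h_triangle)).holonomy
  have h_edge : ∀ {v w : X} (e : Adjacent (ripsComplex X p hp) v w),
      Φ.precomp i (edge e) = ripsRetraction hp hgeo x₀ (edge e) := by
    intro v w e
    have hvw := (ripsComplex_adjacent_iff hp).1 e
    have e' := (ripsComplex_adjacent_iff hq).2 (hvw.trans_le hpq)
    calc Φ.precomp i (edge e) = Φ (edge e') :=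
          congrArg Φ.toFun (edge_map_inclusion _ e e')
      _ = ripsHolonomy hp hgeo x₀ (hgeo.geodesicClass v w) := holonomy_edge _ _ e'
      _ = _ := ripsHolonomy_of_hasLengthLE hp hgeo x₀ (hgeo.hasLengthLE_geodesicClass v w) hvw
  rw [injective_iff_map_eq_one]
  intro a ha
  rw [ripsPi1Map_apply] at ha
  suffices ripsRetraction hp hgeo x₀ (FundamentalGroup.toPath a) = 1 from
    (PathHom.ofBasePaths_eq_one_iff _ (FundamentalGroup.toPath a)).1 this
  calc ripsRetraction hp hgeo x₀ (FundamentalGroup.toPath a)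
      = Φ.precomp i (FundamentalGroup.toPath a) := (pathHom_eq_of_eq_on_edges h_edge _).symm
    _ = Φ (Path.Homotopic.Quotient.refl _) := congrArg Φ.toFun ha
    _ = 1 := Φ.map_refl _

end BondingMap

end Rips

/-! ### Critical values -/

namespace IsSLSCRadius

open Filter

variable {X : Type*} [MetricSpace X] [CompactSpace X] {R : ℝ} (hR : IsSLSCRadius X R)
  (hgeo : IsGeodesicSpace X) (x₀ : X) {p q : ℝ}
include hR

theorem exists_shortest_isGeodesicCircle_of_not_bijective (hp : 0 < p) (hq : 0 < q) (hpq : p ≤ q)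
    (h : ¬ Function.Bijective (ripsPi1Map x₀ p q hp hq hpq)) :
    ∃ (l : ℝ) (c : C(UnitAddCircle, X)), IsGeodesicCircle l c ∧ 3 * p ≤ l ∧ l < 3 * q ∧
      ripsHolonomy hp hgeo x₀ ⟦circleLoop c⟧ₕ ≠ 1 ∧
      ∀ {w : X} (b : PathClass w w) {l' : ℝ}, HasLengthLE b l' →
        ripsHolonomy hp hgeo x₀ b ≠ 1 → l ≤ l' := by
  obtain ⟨x, b, L, hbL, hLq, hb⟩ : ∃ (x : X) (b : PathClass x x) (L : ℝ),
      HasLengthLE b L ∧ L < 3 * q ∧ ripsHolonomy hp hgeo x₀ b ≠ 1 := by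
    by_contra! h_trivial
    exact h ⟨ripsPi1Map_injective hgeo x₀ hp hq hpq (h_trivial _ _ _),
      ripsPi1Map_surjective hgeo x₀ hp hq hpq⟩
  obtain ⟨l, c, hc, hne, hmin⟩ := hR.exists_shortest_isGeodesicCircle hgeo _ hb
  exact ⟨l, c, hc, not_lt.1 fun hl => hne (ripsHolonomy_eq_one hp hgeo x₀ hc.hasLengthLE hl),
    (hmin b hbL hb).trans_lt hLq, hne, hmin⟩

theorem exists_isGeodesicCircle_of_isRightCriticalValue (h : IsRightCriticalValue x₀ q) :
    ∃ (hq : 0 < q) (c : C(UnitAddCircle, X)), IsGeodesicCircle (3 * q) c ∧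
      ripsHolonomy hq hgeo x₀ ⟦circleLoop c⟧ₕ ≠ 1 := by
  obtain ⟨hq, h⟩ := h
  obtain ⟨l, c, hc, hql, -, hne, hmin⟩ :=
    hR.exists_shortest_isGeodesicCircle_of_not_bijective hgeo x₀ hq _ _ (h 1 one_pos)
  have hlq : l ≤ 3 * q := by
    by_contra! hlt
    obtain ⟨l', c', hc', -, hl', hne', -⟩ := hR.exists_shortest_isGeodesicCircle_of_not_bijective
      hgeo x₀ hq _ _ (h (l / 3 - q) (by linarith))
    linarith [hmin _ hc'.hasLengthLE hne']
  obtain rfl := hlq.antisymm hql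
  exact ⟨hq, c, hc, hne⟩

include hgeo in
theorem eventually_bijective_ripsPi1Map (hq : 0 < q) :
    ∀ᶠ p in 𝓝 q, ∀ (hp : 0 < p) (hpq : p ≤ q),
      Function.Bijective (ripsPi1Map x₀ p q hp hq hpq) := by
  let F : Set (Quotient (freeHomotopySetoid X)) :=
    {C | ∃ (l : ℝ) (c : C(UnitAddCircle, X)),
      IsGeodesicCircle l c ∧ l < 3 * q ∧ freeHomotopyClass c = C}
  have hF : F.Finite := (hR.finite_freeHomotopyClass hgeo).subset
    fun C ⟨l, c, hc, _, hC⟩ => ⟨l, c, hc, hC⟩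
  have h_shorter : ∀ᶠ p in 𝓝 q, ∀ C ∈ F, ∃ (l : ℝ) (c : C(UnitAddCircle, X)),
      IsGeodesicCircle l c ∧ l < 3 * p ∧ freeHomotopyClass c = C := by
    refine (eventually_all_finite hF).2 fun C ⟨l, c, hc, hl, hC⟩ => ?_
    filter_upwards [lt_mem_nhds (show l / 3 < q by linarith)] with p hp
    exact ⟨l, c, hc, by linarith, hC⟩
  filter_upwards [h_shorter] with p h hp hpq
  by_contra h_bij
  obtain ⟨l, c, hc, -, hl, hne, -⟩ :=
    hR.exists_shortest_isGeodesicCircle_of_not_bijective hgeo x₀ hp hq hpq h_bij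
  obtain ⟨l', c', hc', hl', h_class⟩ := h _ ⟨l, c, hc, hl, rfl⟩
  exact hne (((ripsHolonomy hp hgeo x₀).map_circleLoop_eq_one_iff (Quotient.exact h_class)).1
    (ripsHolonomy_eq_one hp hgeo x₀ hc'.hasLengthLE hl'))

include hgeo in
theorem not_isLeftCriticalValue (q : ℝ) : ¬ IsLeftCriticalValue x₀ q := by
  rintro ⟨hq, ε₀, hε₀, h⟩
  obtain ⟨p, h_bij, hp, hεp, hpq⟩ := ((eventually_nhdsWithin_of_eventually_nhds
    (hR.eventually_bijective_ripsPi1Map hgeo x₀ hq)).and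
      (eventually_nhdsWithin_of_eventually_nhds (eventually_gt_nhds hq) |>.and
        (Ioo_mem_nhdsLT (sub_lt_self q hε₀)))).exists
  obtain ⟨ε, rfl⟩ : ∃ ε, p = q - ε := ⟨q - p, (sub_sub_cancel q p).symm⟩
  exact h ε (sub_lt_self_iff q |>.1 hpq) (sub_lt_sub_iff_left q |>.1 hεp) hp (h_bij hp hpq.le)

theorem exists_isGeodesicCircle_of_isCriticalValue (h : IsCriticalValue x₀ q) :
    ∃ (hq : 0 < q) (c : C(UnitAddCircle, X)), IsGeodesicCircle (3 * q) c ∧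
      ripsHolonomy hq hgeo x₀ ⟦circleLoop c⟧ₕ ≠ 1 :=
  hR.exists_isGeodesicCircle_of_isRightCriticalValue hgeo x₀
    (h.resolve_left (hR.not_isLeftCriticalValue hgeo x₀ q))

include hgeo in
theorem finite_isCriticalValue : {q : ℝ | IsCriticalValue x₀ q}.Finite := by
  choose hpos c hc hne using fun q : {q : ℝ | IsCriticalValue x₀ q} =>
    hR.exists_isGeodesicCircle_of_isCriticalValue hgeo x₀ q.2
  have h_inj : Function.Injective fun q => freeHomotopyClass (c q) := by
    refine .of_lt_imp_ne fun q q' hqq' h_class => hne q' ?_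
    exact ((ripsHolonomy _ hgeo x₀).map_circleLoop_eq_one_iff (Quotient.exact h_class)).1
      (ripsHolonomy_eq_one (hpos q') hgeo x₀ (hc q).hasLengthLE
        (mul_lt_mul_of_pos_left hqq' three_pos))
  have := ((hR.finite_freeHomotopyClass hgeo).subset
    (Set.range_subset_iff.2 fun q => ⟨_, c q, hc q, rfl⟩)).to_subtype
  exact Set.finite_coe_iff.1 (Finite.of_injective _ (Set.rangeFactorization_injective.2 h_inj))

end IsSLSCRadius

theorem mainTheorem4 {X : Type*} [MetricSpace X] [CompactSpace X]
    (hgeo : IsGeodesicSpace X) (hslsc : IsSLSC X) (x₀ : X) :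
    {q : ℝ | IsCriticalValue x₀ q}.Finite ∧
    (∃ S : Set (FundamentalGroup X x₀),
      S.Finite ∧ S ⊆ geodesicLassoClasses x₀ ∧ Subgroup.closure S = ⊤) ∧
    (∀ q : ℝ, IsCriticalValue x₀ q →
      {C | ∃ c : C(UnitAddCircle, X),
        IsGeodesicCircle (3 * q) c ∧ freeHomotopyClass c = C}.Finite ∧
      ∃ c : C(UnitAddCircle, X), IsGeodesicCircle (3 * q) c) ∧
    {C | ∃ (l : ℝ) (c : C(UnitAddCircle, X)),
      IsGeodesicCircle l c ∧ freeHomotopyClass c = C}.Finite := by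
  obtain ⟨R, hR⟩ := hslsc.exists_isSLSCRadius hgeo
  obtain ⟨S, hS_lasso, hS, hS_closure⟩ := hR.exists_finite_generating_geodesicLassoClasses hgeo x₀
  have h_classes := hR.finite_freeHomotopyClass hgeo
  refine ⟨hR.finite_isCriticalValue hgeo x₀, ⟨S, hS, hS_lasso, hS_closure⟩, fun q hq => ⟨?_, ?_⟩,
    h_classes⟩
  · exact h_classes.subset fun C ⟨c, hc, hC⟩ => ⟨3 * q, c, hc, hC⟩
  · obtain ⟨-, c, hc, -⟩ := hR.exists_isGeodesicCircle_of_isCriticalValue hgeo x₀ hq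
    exact ⟨c, hc⟩
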